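/- A loose path $P_\ell^{(k)}$ is the $k$-uniform hypergraph with vertices $v_1,\dots,v_{(k-1)\ell+1}$ and edges $e_i=\{v_{(i-1)(k-1)+q}: 1\le q\le k\}$, $i=1,\dots,\ell$; $K_n^{(k)}$ is the complete $k$-uniform hypergraph on $n$ vertices. There are an absolute constant $c>0$ and an algorithm such that for all integers $k\ge 2$, $\ell\ge 3$, $r\ge 2$ and $n\ge 2^{r+1}\ell+(k-2)\ell r$ and for every $r$-coloring of the edges of $K_n^{(k)}$, the algorithm, given $k,\ell,r,n$ and the coloring, finds a monochromatic copy of $P_\ell^{(k)}$ in time at most $c\,n^k$. Here an algorithm is a program for a random access machine with unit-cost copying, addition, truncated subtraction, comparison and indirect memory access, in which no sum may exceed $n^k$; the coloring is accessed by queries, each returning the color of one edge given by its $k$ vertices and costing $k$ steps; and the output is the list of the vertices of the copy in their order along the path. -/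

import Mathlib

namespace LoosePath

/-! ### Loose paths, colorings and monochromatic copies -/

/-- The edges of the complete `k`-uniform hypergraph on the vertex set `{0, …, n - 1}`. -/
abbrev Edge (n k : ℕ) : Type := {e : Finset (Fin n) // e.card = k}

/-- The edge `e_i = {v_{i(k-1)}, …, v_{i(k-1)+k-1}}` (indices start at `0`) of the `k`-uniform
loose path of length `ℓ`, whose vertices are `v_0, …, v_{(k-1)ℓ}`. -/
def pathEdge (k ℓ : ℕ) (i : Fin ℓ) : Finset (Fin ((k - 1) * ℓ + 1)) :=
  Finset.univ.filter fun v => (i : ℕ) * (k - 1) ≤ (v : ℕ) ∧ (v : ℕ) < (i : ℕ) * (k - 1) + k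

/-- The edge set of the `k`-uniform loose path of length `ℓ`. -/
def loosePath (k ℓ : ℕ) : Set (Finset (Fin ((k - 1) * ℓ + 1))) :=
  Set.range (pathEdge k ℓ)

/-- The injection `φ` of the vertices of the hypergraph with edge set `F` maps it onto a
monochromatic copy of itself under the edge coloring `χ`. -/
def IsMonochromaticCopy {V : Type} {n k r : ℕ} (χ : Edge n k → Fin r) (F : Set (Finset V))
    (φ : V ↪ Fin n) : Prop :=
  ∃ color : Fin r, ∀ f ∈ F, ∃ e : Edge n k, e.1 = f.map φ ∧ χ e = color

/-! ### A random access machine with a step count -/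

/-- A memory: scalar registers and arrays, all holding natural numbers. A program mentions only
finitely many registers and finitely many arrays. -/
structure Memory where
  reg : ℕ → ℕ
  arr : ℕ → ℕ → ℕ

/-- Overwrite one register. -/
def Memory.setReg (s : Memory) (x v : ℕ) : Memory :=
  { s with reg := Function.update s.reg x v }

/-- Overwrite one array cell. -/
def Memory.setArr (s : Memory) (a i v : ℕ) : Memory :=
  { s with arr := Function.update s.arr a (Function.update (s.arr a) i v) }

/-- Tests on two registers. -/
inductive Test where
  | lt (x y : ℕ)
  | eq (x y : ℕ)

/-- The truth value of a test. -/
def Test.Holds (s : Memory) : Test → Prop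
  | .lt x y => s.reg x < s.reg y
  | .eq x y => s.reg x = s.reg y

/-- Programs. The letters `x y z` are names of registers and `a` is the name of an array. -/
inductive Program where
  | skip
  /-- `x := v` for a fixed number `v` -/
  | const (x v : ℕ)
  /-- `x := y` -/
  | move (x y : ℕ)
  /-- `x := y + z` -/
  | add (x y z : ℕ)
  /-- `x := max (y - z) 0` -/
  | sub (x y z : ℕ)
  /-- `x := a[y]` -/
  | load (x a y : ℕ)
  /-- `a[x] := y` -/
  | store (a x y : ℕ)
  /-- `x :=` the color of the edge `{a[0], …, a[k - 1]}` -/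
  | query (x a : ℕ)
  | seq (p q : Program)
  | ite (b : Test) (p q : Program)
  | loop (b : Test) (p : Program)

/-- `Exec χ B p s t s'`: on a machine whose sums may not exceed `B` and which has access to the
edge coloring `χ`, the program `p` started in the memory `s` halts after exactly `t` steps in the
memory `s'`. Every basic instruction and every evaluation of a test takes one step, except that a
query takes `k` steps, one for each vertex of the edge. A sum above `B`, or a query of `k` numbers
that do not form an edge, blocks the machine. -/
inductive Exec {n k r : ℕ} (χ : Edge n k → Fin r) (B : ℕ) :
    Program → Memory → ℕ → Memory → Prop
  | skip (s : Memory) : Exec χ B .skip s 1 s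
  | const (s : Memory) (x v : ℕ) : Exec χ B (.const x v) s 1 (s.setReg x v)
  | move (s : Memory) (x y : ℕ) : Exec χ B (.move x y) s 1 (s.setReg x (s.reg y))
  | add (s : Memory) (x y z : ℕ) (h : s.reg y + s.reg z ≤ B) :
      Exec χ B (.add x y z) s 1 (s.setReg x (s.reg y + s.reg z))
  | sub (s : Memory) (x y z : ℕ) :
      Exec χ B (.sub x y z) s 1 (s.setReg x (s.reg y - s.reg z))
  | load (s : Memory) (x a y : ℕ) :
      Exec χ B (.load x a y) s 1 (s.setReg x (s.arr a (s.reg y)))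
  | store (s : Memory) (a x y : ℕ) :
      Exec χ B (.store a x y) s 1 (s.setArr a (s.reg x) (s.reg y))
  | query (s : Memory) (x a : ℕ) (e : Edge n k)
      (h : e.1.map Fin.valEmbedding = (Finset.range k).image (s.arr a)) :
      Exec χ B (.query x a) s k (s.setReg x (χ e))
  | seq {p q : Program} {s s' s'' : Memory} {t u : ℕ}
      (hp : Exec χ B p s t s') (hq : Exec χ B q s' u s'') :
      Exec χ B (.seq p q) s (t + u) s''
  | ite_true {b : Test} {p q : Program} {s s' : Memory} {t : ℕ}
      (hb : b.Holds s) (hp : Exec χ B p s t s') : Exec χ B (.ite b p q) s (t + 1) s'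
  | ite_false {b : Test} {p q : Program} {s s' : Memory} {t : ℕ}
      (hb : ¬ b.Holds s) (hq : Exec χ B q s t s') : Exec χ B (.ite b p q) s (t + 1) s'
  | loop_done {b : Test} {p : Program} {s : Memory}
      (hb : ¬ b.Holds s) : Exec χ B (.loop b p) s 1 s
  | loop_step {b : Test} {p : Program} {s s' s'' : Memory} {t u : ℕ}
      (hb : b.Holds s) (hp : Exec χ B p s t s') (hl : Exec χ B (.loop b p) s' u s'') :
      Exec χ B (.loop b p) s (t + u + 1) s''

/-- The machine is deterministic: the running time and the final memory are unique. -/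
theorem Exec.unique {n k r : ℕ} {χ : Edge n k → Fin r} {B : ℕ} {p : Program} {s s₁ s₂ : Memory}
    {t₁ t₂ : ℕ} (h₁ : Exec χ B p s t₁ s₁) (h₂ : Exec χ B p s t₂ s₂) : t₁ = t₂ ∧ s₁ = s₂ := by
  induction h₁ generalizing t₂ s₂ with
  | query s x a e h =>
    cases h₂ with
    | query _ _ _ e' h' =>
      have : e = e' := Subtype.ext (Finset.map_injective _ (h.trans h'.symm))
      subst this
      exact ⟨rfl, rfl⟩
  | seq hp hq ihp ihq =>
    cases h₂ with
    | seq hp' hq' =>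
      obtain ⟨rfl, rfl⟩ := ihp hp'
      obtain ⟨rfl, rfl⟩ := ihq hq'
      exact ⟨rfl, rfl⟩
  | ite_true hb hp ih =>
    cases h₂ with
    | ite_true hb' hp' => obtain ⟨rfl, rfl⟩ := ih hp'; exact ⟨rfl, rfl⟩
    | ite_false hb' hp' => exact absurd hb hb'
  | ite_false hb hp ih =>
    cases h₂ with
    | ite_true hb' hp' => exact absurd hb' hb
    | ite_false hb' hp' => obtain ⟨rfl, rfl⟩ := ih hp'; exact ⟨rfl, rfl⟩
  | loop_done hb =>
    cases h₂ with
    | loop_done hb' => exact ⟨rfl, rfl⟩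
    | loop_step hb' hp' hl' => exact absurd hb' hb
  | loop_step hb hp hl ihp ihl =>
    cases h₂ with
    | loop_done hb' => exact absurd hb hb'
    | loop_step hb' hp' hl' =>
      obtain ⟨rfl, rfl⟩ := ihp hp'
      obtain ⟨rfl, rfl⟩ := ihl hl'
      exact ⟨rfl, rfl⟩
  | _ => cases h₂; exact ⟨rfl, rfl⟩

/-- The initial memory: registers `0, 1, 2, 3` hold `k, ℓ, r, n`, everything else is `0`. -/
def input (k ℓ r n : ℕ) : Memory where
  reg x := if x = 0 then k else if x = 1 then ℓ else if x = 2 then r else if x = 3 then n else 0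
  arr _ _ := 0

/-- Given `k, ℓ, r, n` and any `r`-coloring `χ` of the edges of the complete `k`-uniform
hypergraph on `n` vertices, the program `A` halts after at most `c * n ^ k` steps and then the
cells `0, …, (k-1)ℓ` of array `0` list, in their order along the path, the vertices of a
monochromatic copy of the `k`-uniform loose path of length `ℓ`. Sums are limited to `n ^ k`. -/
def FindsLoosePath (A : Program) (c : ℝ) (k ℓ r n : ℕ) : Prop :=
  ∀ χ : Edge n k → Fin r, ∃ (t : ℕ) (s : Memory),
    Exec χ (n ^ k) A (input k ℓ r n) t s ∧ (t : ℝ) ≤ c * (n : ℝ) ^ k ∧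
    ∃ φ : Fin ((k - 1) * ℓ + 1) ↪ Fin n,
      (∀ i : Fin ((k - 1) * ℓ + 1), s.arr 0 (i : ℕ) = (φ i : ℕ)) ∧ IsMonochromaticCopy χ (loosePath k ℓ) φ

end LoosePath

/-! Set aside `ℓ * r` disjoint blocks of `k - 2` vertices and let `M` be the number of remaining
vertices. A pair of remaining vertices together with a block is an edge. By pigeonhole each pair
gets some color from at least `ℓ` blocks (`exists_le_blockCount`), and this color is assigned to the
pair. In the resulting `r`-coloring of the complete graph on `M ≥ 2 * (r + 1) * ℓ` vertices some
class has at least `ℓ * M` pairs (`exists_large_colorClass`).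

Such a graph contains a path with `ℓ` edges, and depth first search finds it. When a vertex is
abandoned, its neighbors that have not been abandoned all lie on the current path, so it accounts
for at most `ℓ - 1` new edges (`IsSearchState.pop`). If every vertex were abandoned, there would be
at most `(ℓ - 1) * M` edges. Finally each path edge is enlarged by a block not used before: `ℓ`
blocks have the right color and fewer than `ℓ` are taken.

The costly part is coloring the pairs. For one pair all queries take time of order `ℓ * r * k ≤ 3 *
n` (`Setting.blocks_mul_k_le`), which is `O(n ^ (k - 2))` for `k ≥ 3`. For `k = 2` the blocks are
empty and one query decides. With fewer than `n ^ 2` pairs the total is `O(n ^ k)`; search and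
extension take only `O(n ^ 2)`.

Correctness and running time are proved together by a weakest precondition calculus whose
postconditions also see the step count. -/

namespace LoosePath

/-! ### Weakest preconditions for the machine -/

section Hoare

variable {n k r : ℕ} {χ : Edge n k → Fin r} {B : ℕ}

/-- The program `p` started in `s` halts, and its running time and final memory satisfy `Q`. -/
def WP (χ : Edge n k → Fin r) (B : ℕ) (p : Program) (s : Memory) (Q : ℕ → Memory → Prop) : Prop :=
  ∃ t s', Exec χ B p s t s' ∧ Q t s'

theorem WP.mono {p : Program} {s : Memory} {Q R : ℕ → Memory → Prop} (h : WP χ B p s Q)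
    (hQR : ∀ t s', Q t s' → R t s') : WP χ B p s R := by
  obtain ⟨t, s', he, hq⟩ := h
  exact ⟨t, s', he, hQR _ _ hq⟩

theorem wp_skip {s : Memory} {Q : ℕ → Memory → Prop} : WP χ B .skip s Q ↔ Q 1 s := by
  constructor
  · rintro ⟨t, s', he, hq⟩; cases he; exact hq
  · intro h; exact ⟨_, _, .skip s, h⟩

theorem wp_const {s : Memory} {Q : ℕ → Memory → Prop} {x v : ℕ} :
    WP χ B (.const x v) s Q ↔ Q 1 (s.setReg x v) := by
  constructor
  · rintro ⟨t, s', he, hq⟩; cases he; exact hq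
  · intro h; exact ⟨_, _, .const s x v, h⟩

theorem wp_move {s : Memory} {Q : ℕ → Memory → Prop} {x y : ℕ} :
    WP χ B (.move x y) s Q ↔ Q 1 (s.setReg x (s.reg y)) := by
  constructor
  · rintro ⟨t, s', he, hq⟩; cases he; exact hq
  · intro h; exact ⟨_, _, .move s x y, h⟩

theorem wp_add {s : Memory} {Q : ℕ → Memory → Prop} {x y z : ℕ} :
    WP χ B (.add x y z) s Q ↔
      s.reg y + s.reg z ≤ B ∧ Q 1 (s.setReg x (s.reg y + s.reg z)) := by
  constructor
  · rintro ⟨t, s', he, hq⟩; cases he with | add _ _ _ _ h => exact ⟨h, hq⟩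
  · intro h; exact ⟨_, _, .add s x y z h.1, h.2⟩

theorem wp_sub {s : Memory} {Q : ℕ → Memory → Prop} {x y z : ℕ} :
    WP χ B (.sub x y z) s Q ↔ Q 1 (s.setReg x (s.reg y - s.reg z)) := by
  constructor
  · rintro ⟨t, s', he, hq⟩; cases he; exact hq
  · intro h; exact ⟨_, _, .sub s x y z, h⟩

theorem wp_load {s : Memory} {Q : ℕ → Memory → Prop} {x a y : ℕ} :
    WP χ B (.load x a y) s Q ↔ Q 1 (s.setReg x (s.arr a (s.reg y))) := by
  constructor
  · rintro ⟨t, s', he, hq⟩; cases he; exact hq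
  · intro h; exact ⟨_, _, .load s x a y, h⟩

theorem wp_store {s : Memory} {Q : ℕ → Memory → Prop} {a x y : ℕ} :
    WP χ B (.store a x y) s Q ↔ Q 1 (s.setArr a (s.reg x) (s.reg y)) := by
  constructor
  · rintro ⟨t, s', he, hq⟩; cases he; exact hq
  · intro h; exact ⟨_, _, .store s a x y, h⟩

theorem wp_seq {s : Memory} {Q : ℕ → Memory → Prop} {p q : Program} :
    WP χ B (.seq p q) s Q ↔
      WP χ B p s fun t s' => WP χ B q s' fun u s'' => Q (t + u) s'' := by
  constructor
  · rintro ⟨t, s', he, hq⟩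
    cases he with | seq hp hq' => exact ⟨_, _, hp, _, _, hq', hq⟩
  · rintro ⟨t, s', hp, u, s'', hq', hq⟩
    exact ⟨_, _, .seq hp hq', hq⟩

theorem wp_ite {s : Memory} {Q : ℕ → Memory → Prop} {b : Test} {p q : Program} :
    WP χ B (.ite b p q) s Q ↔
      (b.Holds s → WP χ B p s fun t s' => Q (t + 1) s') ∧
      (¬ b.Holds s → WP χ B q s fun t s' => Q (t + 1) s') := by
  constructor
  · rintro ⟨t, s', he, hq⟩
    cases he with
    | ite_true hb hp => exact ⟨fun _ => ⟨_, _, hp, hq⟩, fun h => absurd hb h⟩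
    | ite_false hb hp => exact ⟨fun h => absurd h hb, fun _ => ⟨_, _, hp, hq⟩⟩
  · rintro ⟨h₁, h₂⟩
    by_cases hb : b.Holds s
    · obtain ⟨t, s', hp, hq⟩ := h₁ hb
      exact ⟨_, _, .ite_true hb hp, hq⟩
    · obtain ⟨t, s', hp, hq⟩ := h₂ hb
      exact ⟨_, _, .ite_false hb hp, hq⟩

/-- A loop whose invariant carries a bound on the number of remaining rounds. -/
theorem wp_while {b : Test} {p : Program} (T : ℕ) (Inv : ℕ → Memory → Prop)
    (hstep : ∀ i s, Inv i s → b.Holds s →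
      WP χ B p s fun t s' => t ≤ T ∧ ∃ j < i, Inv j s')
    {i : ℕ} {s : Memory} (h : Inv i s) :
    WP χ B (.loop b p) s fun t s' => t ≤ i * (T + 1) + 1 ∧ (∃ j, Inv j s') ∧ ¬ b.Holds s' := by
  induction i using Nat.strong_induction_on generalizing s with
  | _ i ih =>
    by_cases hb : b.Holds s
    · obtain ⟨t, s', hp, ht, j, hj, hI⟩ := hstep i s h hb
      obtain ⟨u, s'', hl, hu, hQ⟩ := ih j hj hI
      refine ⟨_, _, .loop_step hb hp hl, ?_, hQ⟩
      -- One round costs at most `T` plus one step for the test; the drop from `i` to `j` pays for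
      -- it.
      have : (j + 1) * (T + 1) ≤ i * (T + 1) := Nat.mul_le_mul_right _ hj
      have : (j + 1) * (T + 1) = j * (T + 1) + (T + 1) := by ring
      omega
    · exact ⟨_, _, .loop_done hb, by omega, ⟨_, h⟩, hb⟩

/-- A loop that runs for exactly `N` rounds. -/
theorem wp_for {b : Test} {p : Program} (N T : ℕ) (Inv : ℕ → Memory → Prop)
    (hb : ∀ i s, i ≤ N → Inv i s → (b.Holds s ↔ i < N))
    (hstep : ∀ i s, i < N → Inv i s → WP χ B p s fun t s' => t ≤ T ∧ Inv (i + 1) s')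
    {s : Memory} (h : Inv 0 s) :
    WP χ B (.loop b p) s fun t s' => t ≤ N * (T + 1) + 1 ∧ Inv N s' := by
  -- The decreasing quantity is the number of rounds still to come, so round `i` has measure `N -
  -- i`.
  have key := wp_while (χ := χ) (B := B) (b := b) (p := p) T
    (fun m s => m ≤ N ∧ Inv (N - m) s) ?_ (i := N) (s := s) ⟨le_rfl, by simpa using h⟩
  · refine key.mono ?_
    rintro t s' ⟨ht, ⟨j, hj, hI⟩, hnb⟩
    rw [hb _ _ (by omega) hI] at hnb
    have : N - j = N := by omega
    exact ⟨ht, this ▸ hI⟩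
  · rintro i s ⟨hi, hI⟩ hbs
    have hlt := (hb _ _ (by omega) hI).1 hbs
    refine (hstep _ _ hlt hI).mono ?_
    rintro t s' ⟨ht, hI'⟩
    refine ⟨ht, i - 1, by omega, by omega, ?_⟩
    have : N - (i - 1) = N - i + 1 := by omega
    exact this ▸ hI'

@[simp] theorem holds_lt {s : Memory} {x y : ℕ} : (Test.lt x y).Holds s ↔ s.reg x < s.reg y :=
  Iff.rfl

@[simp] theorem holds_eq {s : Memory} {x y : ℕ} : (Test.eq x y).Holds s ↔ s.reg x = s.reg y :=
  Iff.rfl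

@[simp] theorem reg_setReg (s : Memory) (x v y : ℕ) :
    (s.setReg x v).reg y = if y = x then v else s.reg y := by
  simp [Memory.setReg, Function.update_apply]

@[simp] theorem arr_setReg (s : Memory) (x v : ℕ) : (s.setReg x v).arr = s.arr := rfl

@[simp] theorem reg_setArr (s : Memory) (a i v : ℕ) : (s.setArr a i v).reg = s.reg := rfl

@[simp] theorem arr_setArr (s : Memory) (a i v b : ℕ) :
    (s.setArr a i v).arr b = if b = a then Function.update (s.arr a) i v else s.arr b := by
  simp only [Memory.setArr, Function.update_apply]

/-! ### Colors of edges given as sets of natural numbers -/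

open Classical in
/-- The color of the edge with vertex set `S`. -/
noncomputable def edgeColor (χ : Edge n k → Fin r) (S : Finset ℕ) : ℕ :=
  -- The default `r` is not a color; it is not taken on the vertex set of an edge.
  if h : ∃ e : Edge n k, e.1.map Fin.valEmbedding = S then χ h.choose else r

theorem edgeColor_eq {S : Finset ℕ} {e : Edge n k} (h : e.1.map Fin.valEmbedding = S) :
    edgeColor χ S = χ e := by
  have hex : ∃ e : Edge n k, e.1.map Fin.valEmbedding = S := ⟨e, h⟩
  rw [edgeColor, dif_pos hex]
  have : hex.choose = e :=
    Subtype.ext (Finset.map_injective _ (hex.choose_spec.trans h.symm))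
  rw [this]

theorem exists_edge {S : Finset ℕ} (hS : S.card = k) (hlt : ∀ x ∈ S, x < n) :
    ∃ e : Edge n k, e.1.map Fin.valEmbedding = S := by
  have hmap : (S.attachFin hlt).map Fin.valEmbedding = S := by
    ext x
    simp only [Finset.mem_map, Finset.mem_attachFin, Fin.valEmbedding_apply]
    exact ⟨by rintro ⟨y, hy, rfl⟩; exact hy, fun hx => ⟨⟨x, hlt x hx⟩, hx, rfl⟩⟩
  exact ⟨⟨S.attachFin hlt, by simp [hS]⟩, hmap⟩

theorem edgeColor_lt {S : Finset ℕ} (hS : S.card = k) (hlt : ∀ x ∈ S, x < n) :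
    edgeColor χ S < r := by
  obtain ⟨e, he⟩ := exists_edge hS hlt
  rw [edgeColor_eq he]
  exact (χ e).2

/-- Replaces the edge in the query rule by a set of natural numbers, so that invariants can speak
about array contents alone. -/
theorem wp_query {s : Memory} {Q : ℕ → Memory → Prop} {x a : ℕ} {S : Finset ℕ}
    (hS : S.card = k) (hlt : ∀ x ∈ S, x < n) (himg : (Finset.range k).image (s.arr a) = S)
    (hQ : Q k (s.setReg x (edgeColor χ S))) : WP χ B (.query x a) s Q := by
  obtain ⟨e, he⟩ := exists_edge hS hlt
  refine ⟨_, _, .query s x a e (he.trans himg.symm), ?_⟩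
  rwa [edgeColor_eq he] at hQ

end Hoare

/-! ### Depth first search for a long path in a dense graph -/

section DepthFirst

/-- The pairs `(a, b)` with `b < a < M` that satisfy `G`. -/
def edgePairs (G : ℕ → ℕ → Prop) [DecidableRel G] (M : ℕ) : Finset (ℕ × ℕ) :=
  (Finset.range M ×ˢ Finset.range M).filter fun x => x.2 < x.1 ∧ G x.1 x.2

/-- A state of a depth first search in the graph `G` on `{0, …, M - 1}`: the current path is
`p 1, …, p (m - 1)`, the set of visited vertices is `V`, and those in `D` have been abandoned. -/
structure IsSearchState (G : ℕ → ℕ → Prop) [DecidableRel G] (M ℓ m : ℕ) (p : ℕ → ℕ)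
    (V D : Finset ℕ) : Prop where
  one_le : 1 ≤ m
  lt : ∀ i, 1 ≤ i → i < m → p i < M
  inj : ∀ i j, 1 ≤ i → i < j → j < m → p i ≠ p j
  adj : ∀ i, 1 ≤ i → i + 1 < m → G (p i) (p (i + 1))
  visited : ∀ v < M, v ∈ V ↔ v ∈ D ∨ ∃ i, 1 ≤ i ∧ i < m ∧ p i = v
  sub : D ⊆ Finset.range M
  disj : ∀ i, 1 ≤ i → i < m → p i ∉ D
  -- The counting invariant: on average an abandoned vertex accounts for at most `ℓ - 1` edges.
  sparse : ((edgePairs G M).filter fun x => x.1 ∈ D ∨ x.2 ∈ D).card ≤ (ℓ - 1) * D.card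

variable {G : ℕ → ℕ → Prop} [DecidableRel G] {M ℓ m : ℕ} {p : ℕ → ℕ} {V D : Finset ℕ}

theorem isSearchState_empty : IsSearchState G M ℓ 1 p ∅ ∅ where
  one_le := le_rfl
  lt i h₁ h₂ := by omega
  inj i j h₁ h₂ h₃ := by omega
  adj i h₁ h₂ := by omega
  visited v _ := by
    simp only [Finset.notMem_empty, false_or, false_iff]
    rintro ⟨i, h₁, h₂, -⟩
    omega
  sub := by simp
  disj i h₁ h₂ := by omega
  sparse := by simp

/-- For `m = 1` the path is empty and any unvisited vertex may start a new one, as if a virtual root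
were adjacent to everything. -/
theorem IsSearchState.push (h : IsSearchState G M ℓ m p V D) {v : ℕ} (hv : v < M) (hV : v ∉ V)
    (hG : m = 1 ∨ G (p (m - 1)) v) :
    IsSearchState G M ℓ (m + 1) (Function.update p m v) (insert v V) D := by
  have hup : ∀ i, i < m → Function.update p m v i = p i := fun i hi =>
    Function.update_of_ne (by omega) _ _
  have hvD : ¬ (v ∈ D ∨ ∃ i, 1 ≤ i ∧ i < m ∧ p i = v) := fun h' => hV ((h.visited v hv).2 h')
  push Not at hvD
  have h1 := h.one_le
  refine ⟨by omega, ?_, ?_, ?_, ?_, h.sub, ?_, h.sparse⟩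
  · intro i hi him
    rcases Nat.lt_succ_iff_lt_or_eq.1 him with him | rfl
    · rw [hup i him]; exact h.lt i hi him
    · simpa using hv
  · intro i j hi hij hj
    rw [hup i (by omega)]
    rcases Nat.lt_succ_iff_lt_or_eq.1 hj with hj | rfl
    · rw [hup j hj]; exact h.inj i j hi hij hj
    · simpa using hvD.2 i hi hij
  · intro i hi him
    rw [hup i (by omega)]
    rcases Nat.lt_succ_iff_lt_or_eq.1 him with him | him
    · rw [hup _ him]; exact h.adj i hi him
    · subst him
      rw [Function.update_self]
      rcases hG with hG | hG
      · omega
      · simpa using hG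
  · intro w hw
    rw [Finset.mem_insert, h.visited w hw]
    constructor
    · rintro (rfl | hD | ⟨i, hi, him, rfl⟩)
      · exact Or.inr ⟨m, h1, by omega, by simp⟩
      · exact Or.inl hD
      · exact Or.inr ⟨i, hi, by omega, hup i him⟩
    · rintro (hD | ⟨i, hi, him, rfl⟩)
      · exact Or.inr (Or.inl hD)
      · rcases Nat.lt_succ_iff_lt_or_eq.1 him with him | rfl
        · exact Or.inr (Or.inr ⟨i, hi, him, (hup i him).symm⟩)
        · simp
  · intro i hi him
    rcases Nat.lt_succ_iff_lt_or_eq.1 him with him | rfl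
    · rw [hup i him]; exact h.disj i hi him
    · simpa using hvD.1

/-- The last vertex has no unvisited neighbor, so its neighbors outside `D` are earlier path
vertices. There are `m - 2 ≤ ℓ - 1` of these, which bounds the edges newly touched by `D`. -/
theorem IsSearchState.pop (h : IsSearchState G M ℓ m p V D)
    (hsymm : ∀ a b, b < a → a < M → G a b → G b a) (hm : 2 ≤ m) (hmℓ : m ≤ ℓ + 1)
    (hdead : ∀ v < M, v ∉ V → ¬ G (p (m - 1)) v) :
    IsSearchState G M ℓ (m - 1) p V (insert (p (m - 1)) D) := by
  set w := p (m - 1) with hw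
  have hwM : w < M := h.lt _ (by omega) (by omega)
  have hwD : w ∉ D := h.disj _ (by omega) (by omega)
  refine ⟨by omega, fun i hi him => h.lt i hi (by omega),
    fun i j hi hij hj => h.inj i j hi hij (by omega), fun i hi him => h.adj i hi (by omega),
    ?_, ?_, ?_, ?_⟩
  · intro v hv
    rw [h.visited v hv, Finset.mem_insert]
    constructor
    · rintro (hD | ⟨i, hi, him, rfl⟩)
      · exact Or.inl (Or.inr hD)
      · by_cases him' : i = m - 1
        · subst him'; exact Or.inl (Or.inl rfl)
        · exact Or.inr ⟨i, hi, by omega, rfl⟩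
    · rintro ((rfl | hD) | ⟨i, hi, him, rfl⟩)
      · exact Or.inr ⟨m - 1, by omega, by omega, rfl⟩
      · exact Or.inl hD
      · exact Or.inr ⟨i, hi, by omega, rfl⟩
  · intro x hx
    rcases Finset.mem_insert.1 hx with rfl | hx
    · simpa using hwM
    · exact h.sub hx
  · intro i hi him
    rw [Finset.mem_insert]
    rintro (hiw | hD)
    · exact h.inj i (m - 1) hi him (by omega) hiw
    · exact h.disj i hi (by omega) hD
  · have hnbr : ∀ x < M, x ≠ w → x ∉ D → G w x → x ∈ (Finset.Ico 1 (m - 1)).image p := by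
      intro x hx hxw hxD hG
      have hxV : x ∈ V := by
        by_contra hxV
        exact hdead x hx hxV hG
      rcases (h.visited x hx).1 hxV with hD | ⟨i, hi, him, rfl⟩
      · exact absurd hD hxD
      · refine Finset.mem_image_of_mem _ (Finset.mem_Ico.2 ⟨hi, ?_⟩)
        rcases Nat.lt_or_ge i (m - 1) with hlt | hge
        · exact hlt
        · exact absurd (by rw [hw]; congr 1; omega) hxw
    -- A new edge joins `w` to an earlier path vertex; `max` and `min` put it into the order used by
    -- `edgePairs`.
    have hsub : ((edgePairs G M).filter fun x => x.1 ∈ insert w D ∨ x.2 ∈ insert w D) ⊆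
        ((edgePairs G M).filter fun x => x.1 ∈ D ∨ x.2 ∈ D) ∪
          ((Finset.Ico 1 (m - 1)).image p).image fun x => (max w x, min w x) := by
      rintro ⟨a, b⟩ hab
      rw [Finset.mem_filter] at hab
      obtain ⟨habG, hab⟩ := hab
      by_cases hold : a ∈ D ∨ b ∈ D
      · exact Finset.mem_union_left _ (Finset.mem_filter.2 ⟨habG, hold⟩)
      · push Not at hold
        refine Finset.mem_union_right _ ?_
        simp only [edgePairs, Finset.mem_filter, Finset.mem_product, Finset.mem_range] at habG
        obtain ⟨⟨ha, hb⟩, hlt, hG⟩ := habG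
        simp only [Finset.mem_insert, hold.1, hold.2, or_false] at hab
        rcases hab with rfl | rfl
        · exact Finset.mem_image.2 ⟨b, hnbr b hb (by omega) hold.2 hG, by
            rw [max_eq_left hlt.le, min_eq_right hlt.le]⟩
        · exact Finset.mem_image.2 ⟨a, hnbr a ha (by omega) hold.1 (hsymm a _ hlt ha hG), by
            rw [max_eq_right hlt.le, min_eq_left hlt.le]⟩
    calc _ ≤ _ := Finset.card_le_card hsub
      _ ≤ _ := Finset.card_union_le _ _
      _ ≤ (ℓ - 1) * D.card + (ℓ - 1) := by
        refine Nat.add_le_add h.sparse ?_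
        refine Finset.card_image_le.trans (Finset.card_image_le.trans ?_)
        rw [Nat.card_Ico]
        omega
      _ = (ℓ - 1) * (insert w D).card := by
        rw [Finset.card_insert_of_notMem hwD]; ring

/-- With the path empty and everything visited, all vertices are abandoned, so `sparse` counts every
edge. This is the contradiction that keeps the search from failing. -/
theorem IsSearchState.card_edgePairs_le (h : IsSearchState G M ℓ 1 p V D)
    (hV : ∀ v < M, v ∈ V) : (edgePairs G M).card ≤ (ℓ - 1) * M := by
  have hD : D = Finset.range M := by
    refine Finset.Subset.antisymm h.sub fun v hv => ?_
    rw [Finset.mem_range] at hv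
    rcases (h.visited v hv).1 (hV v hv) with hD | ⟨i, h₁, h₂, -⟩
    · exact hD
    · omega
  have hs := h.sparse
  rw [hD, Finset.card_range, Finset.filter_true_of_mem] at hs
  · exact hs
  · rintro ⟨a, b⟩ hab
    simp only [edgePairs, Finset.mem_filter, Finset.mem_product] at hab
    exact Or.inl hab.1.1

end DepthFirst

/-! ### A dense color class -/

/-- Among the pairs `b < a < M`, some color class is large. -/
theorem exists_large_colorClass {M ℓ r : ℕ} (hℓ : 1 ≤ ℓ) (hM : 2 ^ (r + 1) * ℓ ≤ M)
    (col : ℕ → ℕ → ℕ) (hcol : ∀ a b, b < a → a < M → col a b < r) :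
    ∃ c < r, ℓ * M ≤ (edgePairs (fun a b => col a b = c) M).card := by
  by_contra! hcon
  -- Pairs are counted by their larger element, which gives `M * (M - 1) / 2`.
  have hsum : ∑ a ∈ Finset.range M, a =
      ((Finset.range M ×ˢ Finset.range M).filter fun x => x.2 < x.1).card := by
    rw [Finset.card_filter, Finset.sum_product]
    refine Finset.sum_congr rfl fun a ha => ?_
    rw [← Finset.card_filter]
    have : (Finset.range M).filter (fun b => b < a) = Finset.range a := by
      ext b; simp only [Finset.mem_filter, Finset.mem_range] at ha ⊢; omega
    simp [this]
  have hfib : ((Finset.range M ×ˢ Finset.range M).filter fun x => x.2 < x.1).card =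
      ∑ c ∈ Finset.range r, (edgePairs (fun a b => col a b = c) M).card := by
    rw [Finset.card_eq_sum_card_fiberwise (f := fun x => col x.1 x.2) (t := Finset.range r)]
    · refine Finset.sum_congr rfl fun c _ => ?_
      rw [edgePairs, Finset.filter_filter]
    · rintro ⟨a, b⟩ hab
      simp only [Finset.coe_filter, Finset.mem_product, Finset.mem_range, Set.mem_ofPred_eq] at hab
      simpa using hcol a b hab.2 hab.1.1
  have hle : ∑ c ∈ Finset.range r, (edgePairs (fun a b => col a b = c) M).card ≤
      r * (ℓ * M) := by
    calc _ ≤ ∑ c ∈ Finset.range r, ℓ * M :=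
          Finset.sum_le_sum fun c hc => (hcon c (Finset.mem_range.1 hc)).le
      _ = _ := by simp
  have hg := Finset.sum_range_id_mul_two M
  rw [hsum, hfib] at hg
  -- Only this linear consequence of the exponential bound is needed.
  have hpow : 2 * (r + 1) * ℓ ≤ M := by
    refine le_trans ?_ hM
    rw [pow_succ']
    exact Nat.mul_le_mul_right _ (Nat.mul_le_mul_left _ (Nat.lt_two_pow_self (n := r)))
  -- Twice the number of pairs exceeds `2 * r * ℓ * M` by at least `M`, whereas `r` small classes
  -- allow at most `2 * r * ℓ * M`.
  have h1 : M * (2 * r * ℓ + 1) ≤ M * (M - 1) := by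
    refine Nat.mul_le_mul_left _ ?_
    have : 2 * (r + 1) * ℓ = 2 * r * ℓ + 2 * ℓ := by ring
    omega
  have h2 : M * (2 * r * ℓ + 1) = r * (ℓ * M) * 2 + M := by ring
  have h3 : 0 < M := by
    have : 0 < 2 * (r + 1) * ℓ := by positivity
    omega
  omega

/-! ### The shape of the path -/

section Shape

/-- The `j`-th block of `k - 2` consecutive numbers from `M` on. -/
def block (k M j : ℕ) : Finset ℕ := Finset.Ico (M + j * (k - 2)) (M + (j + 1) * (k - 2))

/-- The vertices of a loose path with joints `p 0, p 1, …` whose `i`-th edge is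
`{p i, p (i + 1)} ∪ block k M (b i)`. -/
def pathVertex (k M : ℕ) (p b : ℕ → ℕ) (x : ℕ) : ℕ :=
  -- For `k = 2` the modulus is `1` and every position is a joint.
  if x % (k - 1) = 0 then p (x / (k - 1))
  else M + b (x / (k - 1)) * (k - 2) + (x % (k - 1) - 1)

variable {k M : ℕ} {p b : ℕ → ℕ}

theorem pathVertex_joint (hk : 2 ≤ k) (i : ℕ) : pathVertex k M p b (i * (k - 1)) = p i := by
  rw [pathVertex, if_pos (Nat.mul_mod_left _ _), Nat.mul_div_cancel _ (by omega)]

theorem pathVertex_inner {s : ℕ} (hs : s < k - 2) (i : ℕ) :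
    pathVertex k M p b (i * (k - 1) + 1 + s) = M + b i * (k - 2) + s := by
  have h1 : (i * (k - 1) + 1 + s) % (k - 1) = 1 + s := by
    rw [add_assoc, Nat.mul_add_mod_self_right, Nat.mod_eq_of_lt (by omega)]
  have h2 : (i * (k - 1) + 1 + s) / (k - 1) = i := by
    rw [add_assoc, mul_comm, Nat.mul_add_div (by omega), Nat.div_eq_of_lt (by omega), add_zero]
  rw [pathVertex, if_neg (by omega), h1, h2]
  omega

theorem position_cases (hk : 2 ≤ k) (x : ℕ) :
    ∃ i, x = i * (k - 1) ∨ ∃ s < k - 2, x = i * (k - 1) + 1 + s := by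
  refine ⟨x / (k - 1), ?_⟩
  have h := Nat.div_add_mod' x (k - 1)
  have hlt := Nat.mod_lt x (show 0 < k - 1 by omega)
  by_cases h0 : x % (k - 1) = 0
  · left; omega
  · right; exact ⟨x % (k - 1) - 1, by omega, by omega⟩

/-- The two ends of the `i`-th interval of positions are joints, and the `k - 2` positions between
them run through one block. This matches path edges with the edges that are queried. -/
theorem image_pathVertex (hk : 2 ≤ k) (i : ℕ) :
    (Finset.Ico (i * (k - 1)) (i * (k - 1) + k)).image (pathVertex k M p b) =
      {p i, p (i + 1)} ∪ block k M (b i) := by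
  have hlast : (i + 1) * (k - 1) = i * (k - 1) + (k - 1) := by ring
  have hblock : M + (b i + 1) * (k - 2) = M + b i * (k - 2) + (k - 2) := by ring
  ext y
  simp only [Finset.mem_image, Finset.mem_Ico, Finset.mem_union, Finset.mem_insert,
    Finset.mem_singleton, block, hblock]
  constructor
  · rintro ⟨x, ⟨hx₁, hx₂⟩, rfl⟩
    by_cases h0 : x = i * (k - 1)
    · rw [h0, pathVertex_joint hk]; simp
    · by_cases h1 : x = (i + 1) * (k - 1)
      · rw [h1, pathVertex_joint hk]; simp
      · have : x = i * (k - 1) + 1 + (x - i * (k - 1) - 1) := by omega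
        rw [this, pathVertex_inner (by omega)]
        right; omega
  · rintro ((rfl | rfl) | ⟨h₁, h₂⟩)
    · exact ⟨i * (k - 1), by omega, pathVertex_joint hk i⟩
    · exact ⟨(i + 1) * (k - 1), by omega, pathVertex_joint hk _⟩
    · refine ⟨i * (k - 1) + 1 + (y - (M + b i * (k - 2))), by omega, ?_⟩
      rw [pathVertex_inner (by omega)]
      omega

theorem card_pair_union_block {u v j : ℕ} (hk : 2 ≤ k) (hu : u < M) (hv : v < M) (huv : u ≠ v) :
    ({u, v} ∪ block k M j : Finset ℕ).card = k := by
  rw [Finset.card_union_of_disjoint, Finset.card_pair huv, block, Nat.card_Ico]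
  · have : (j + 1) * (k - 2) = j * (k - 2) + (k - 2) := by ring
    omega
  · rw [Finset.disjoint_left]
    intro x hx
    simp only [Finset.mem_insert, Finset.mem_singleton] at hx
    simp only [block, Finset.mem_Ico]
    omega

theorem lt_of_mem_pair_union_block {u v j J n x : ℕ} (hu : u < M) (hv : v < M) (hj : j < J)
    (hn : M + J * (k - 2) ≤ n) (hx : x ∈ ({u, v} ∪ block k M j : Finset ℕ)) : x < n := by
  simp only [Finset.mem_union, Finset.mem_insert, Finset.mem_singleton, block,
    Finset.mem_Ico] at hx
  have : (j + 1) * (k - 2) ≤ J * (k - 2) := Nat.mul_le_mul_right _ hj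
  omega

/-- Joints lie below `M` and block vertices do not; joints are distinct, and different edges use
different blocks, which are disjoint. -/
theorem pathVertex_injective {ℓ : ℕ} (hk : 2 ≤ k) (hp : ∀ i ≤ ℓ, p i < M)
    (hpi : ∀ i j, i < j → j ≤ ℓ → p i ≠ p j) (hbi : ∀ i j, i < j → j < ℓ → b i ≠ b j)
    {x y : ℕ} (hx : x ≤ (k - 1) * ℓ) (hy : y ≤ (k - 1) * ℓ)
    (h : pathVertex k M p b x = pathVertex k M p b y) : x = y := by
  have hle : ∀ i, i * (k - 1) ≤ (k - 1) * ℓ → i ≤ ℓ := fun i hi => by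
    rw [mul_comm] at hi
    exact Nat.le_of_mul_le_mul_left hi (by omega)
  have hlt : ∀ i s, i * (k - 1) + 1 + s ≤ (k - 1) * ℓ → i < ℓ := fun i s hi => by
    have : (k - 1) * i < (k - 1) * ℓ := by rw [mul_comm]; omega
    exact Nat.lt_of_mul_lt_mul_left this
  obtain ⟨i, hi⟩ := position_cases hk x
  obtain ⟨j, hj⟩ := position_cases hk y
  rcases hi with rfl | ⟨s, hs, rfl⟩ <;> rcases hj with rfl | ⟨s', hs', rfl⟩
  · rw [pathVertex_joint hk, pathVertex_joint hk] at h
    rcases lt_trichotomy i j with hij | rfl | hij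
    · exact absurd h (hpi i j hij (hle j hy))
    · rfl
    · exact absurd h.symm (hpi j i hij (hle i hx))
  · rw [pathVertex_joint hk, pathVertex_inner hs'] at h
    have := hp i (hle i hx)
    omega
  · rw [pathVertex_joint hk, pathVertex_inner hs] at h
    have := hp j (hle j hy)
    omega
  · rw [pathVertex_inner hs, pathVertex_inner hs'] at h
    have hb : b i = b j := by
      rcases lt_trichotomy (b i) (b j) with hij | hij | hij
      · have : (b i + 1) * (k - 2) ≤ b j * (k - 2) := Nat.mul_le_mul_right _ hij
        rw [add_mul] at this
        omega
      · exact hij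
      · have : (b j + 1) * (k - 2) ≤ b i * (k - 2) := Nat.mul_le_mul_right _ hij
        rw [add_mul] at this
        omega
    rcases lt_trichotomy i j with hij | rfl | hij
    · exact absurd hb (hbi i j hij (hlt j s' hy))
    · omega
    · exact absurd hb.symm (hbi j i hij (hlt i s hx))

end Shape

/-- Joints and blocks of one color give a monochromatic loose path. -/
theorem exists_monochromatic_copy {n k r ℓ M J c : ℕ} {χ : Edge n k → Fin r} (hk : 2 ≤ k)
    (hℓ : 1 ≤ ℓ) (hn : M + J * (k - 2) ≤ n) {p b : ℕ → ℕ} (hp : ∀ i ≤ ℓ, p i < M)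
    (hpi : ∀ i j, i < j → j ≤ ℓ → p i ≠ p j) (hb : ∀ i < ℓ, b i < J)
    (hbi : ∀ i j, i < j → j < ℓ → b i ≠ b j)
    (hc : ∀ i < ℓ, edgeColor χ ({p i, p (i + 1)} ∪ block k M (b i)) = c) :
    ∃ φ : Fin ((k - 1) * ℓ + 1) ↪ Fin n,
      (∀ i : Fin ((k - 1) * ℓ + 1), pathVertex k M p b (i : ℕ) = (φ i : ℕ)) ∧
        IsMonochromaticCopy χ (loosePath k ℓ) φ := by
  have hmem : ∀ i < ℓ, ∀ x, i * (k - 1) ≤ x → x < i * (k - 1) + k →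
      pathVertex k M p b x < n := by
    intro i hi x hx₁ hx₂
    refine lt_of_mem_pair_union_block (hp i hi.le) (hp (i + 1) hi) (hb i hi) hn ?_
    rw [← image_pathVertex hk i]
    exact Finset.mem_image_of_mem _ (Finset.mem_Ico.2 ⟨hx₁, hx₂⟩)
  have hlt : ∀ x : Fin ((k - 1) * ℓ + 1), pathVertex k M p b x < n := by
    intro ⟨x, hx⟩
    rcases Nat.lt_or_ge x ((k - 1) * ℓ) with hx' | hx'
    · have hdiv : x / (k - 1) < ℓ := Nat.div_lt_of_lt_mul hx'
      have h1 := Nat.div_add_mod' x (k - 1)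
      have h2 := Nat.mod_lt x (show 0 < k - 1 by omega)
      exact hmem _ hdiv x (by omega) (by omega)
    -- The last vertex has quotient `ℓ`, which is not the index of an edge; it belongs to edge `ℓ -
    -- 1`.
    · have hx'' : x = (k - 1) * ℓ := by omega
      subst hx''
      have : (k - 1) * ℓ = (ℓ - 1) * (k - 1) + (k - 1) := by
        rw [mul_comm, ← Nat.succ_mul]; congr 1; omega
      exact hmem (ℓ - 1) (by omega) ((k - 1) * ℓ) (by omega) (by omega)
  let φ : Fin ((k - 1) * ℓ + 1) ↪ Fin n :=
    ⟨fun x => ⟨pathVertex k M p b x, hlt x⟩, fun x y hxy => by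
      have hxy := congrArg Fin.val hxy
      exact Fin.ext (pathVertex_injective hk hp hpi hbi (by omega) (by omega) hxy)⟩
  refine ⟨φ, fun _ => rfl, ?_⟩
  have hmap : ∀ i : Fin ℓ, ((pathEdge k ℓ i).map φ).map Fin.valEmbedding =
      {p i, p (i + 1)} ∪ block k M (b i) := by
    intro i
    rw [← image_pathVertex hk i]
    ext y
    simp only [Finset.mem_map, pathEdge, Finset.mem_filter, Finset.mem_univ, true_and,
      Finset.mem_image, Finset.mem_Ico, Fin.valEmbedding_apply]
    constructor
    · rintro ⟨_, ⟨x, hx, rfl⟩, rfl⟩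
      exact ⟨x, hx, rfl⟩
    · rintro ⟨x, hx, rfl⟩
      have : ((i : ℕ) + 1) * (k - 1) ≤ ℓ * (k - 1) := Nat.mul_le_mul_right _ i.2
      rw [add_mul, one_mul, mul_comm ℓ] at this
      exact ⟨_, ⟨⟨x, by omega⟩, hx, rfl⟩, rfl⟩
  have hcard : ∀ i : Fin ℓ, ((pathEdge k ℓ i).map φ).card = k := by
    intro i
    rw [← Finset.card_map Fin.valEmbedding, hmap i]
    exact card_pair_union_block hk (hp i i.2.le) (hp _ i.2) (hpi i _ (by omega) i.2)
  have hcol : ∀ i : Fin ℓ, (χ ⟨_, hcard i⟩ : ℕ) = c := by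
    intro i
    rw [← hc i i.2]
    exact (edgeColor_eq (hmap i)).symm
  refine ⟨χ ⟨_, hcard ⟨0, hℓ⟩⟩, ?_⟩
  rintro _ ⟨i, rfl⟩
  exact ⟨⟨_, hcard i⟩, rfl, Fin.ext ((hcol i).trans (hcol _).symm)⟩

/-! ### The setting shared by all parts of the program

Registers: `0, …, 3` hold `k, ℓ, r, n`; `4` holds `1`; `5` holds `k - 2`; `6` holds the number
`ℓ * r` of blocks; `7` holds the number `M` of vertices outside the blocks; `8` holds `ℓ * M`;
`9` holds the chosen color; `10` holds `0`.

Arrays: `0` output, `1` the vertices of a query, `2` the multiples of `M`, `3` the colors of pairs,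
`4` the color counts of one pair, `5` the color counts of all pairs, `6` visited vertices,
`7` the path, `8` used blocks. -/

/-- The relations between the numbers that occur in the program. -/
structure Setting (k ℓ r n M B : ℕ) : Prop where
  two_le_k : 2 ≤ k
  three_le_ℓ : 3 ≤ ℓ
  two_le_r : 2 ≤ r
  add_eq : M + ℓ * r * (k - 2) = n
  pow_le : 2 ^ (r + 1) * ℓ ≤ M
  sq_le : n * n ≤ B
  k_le : k ≤ B

/-- The contents of the registers that are not changed after the preparation. -/
structure Constants (k ℓ r n M : ℕ) (s : Memory) : Prop where
  r0 : s.reg 0 = k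
  r1 : s.reg 1 = ℓ
  r2 : s.reg 2 = r
  r3 : s.reg 3 = n
  r4 : s.reg 4 = 1
  r5 : s.reg 5 = k - 2
  r6 : s.reg 6 = ℓ * r
  r7 : s.reg 7 = M
  r8 : s.reg 8 = ℓ * M
  r10 : s.reg 10 = 0

section

variable {n k ℓ r M B : ℕ} {s s' : Memory} {χ : Edge n k → Fin r}

/-- Register `9` is exempt because the chosen color may still change while pairs are being colored.
-/
theorem Constants.congr (h : Constants k ℓ r n M s)
    (hs : ∀ x < 11, x ≠ 9 → s'.reg x = s.reg x) : Constants k ℓ r n M s' where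
  r0 := (hs 0 (by omega) (by omega)).trans h.r0
  r1 := (hs 1 (by omega) (by omega)).trans h.r1
  r2 := (hs 2 (by omega) (by omega)).trans h.r2
  r3 := (hs 3 (by omega) (by omega)).trans h.r3
  r4 := (hs 4 (by omega) (by omega)).trans h.r4
  r5 := (hs 5 (by omega) (by omega)).trans h.r5
  r6 := (hs 6 (by omega) (by omega)).trans h.r6
  r7 := (hs 7 (by omega) (by omega)).trans h.r7
  r8 := (hs 8 (by omega) (by omega)).trans h.r8
  r10 := (hs 10 (by omega) (by omega)).trans h.r10

theorem Setting.mul_ℓ_le (h : Setting k ℓ r n M B) : 2 * (r + 1) * ℓ ≤ M := by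
  refine le_trans ?_ h.pow_le
  rw [pow_succ']
  exact Nat.mul_le_mul_right _ (Nat.mul_le_mul_left _ (Nat.lt_two_pow_self (n := r)))

theorem Setting.ℓr_le (h : Setting k ℓ r n M B) : 2 * (ℓ * r) + 2 * ℓ ≤ M := by
  have := h.mul_ℓ_le
  have : 2 * (r + 1) * ℓ = 2 * (ℓ * r) + 2 * ℓ := by ring
  omega

theorem Setting.r_le (h : Setting k ℓ r n M B) : 3 * r ≤ ℓ * r :=
  Nat.mul_le_mul_right _ h.three_le_ℓ

theorem Setting.M_le (h : Setting k ℓ r n M B) : M ≤ n := by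
  have := h.add_eq
  omega

/-- Leaves room for sums of a few numbers of size at most `n`. -/
theorem Setting.n_le (h : Setting k ℓ r n M B) : 3 * n ≤ B := by
  have h1 := h.ℓr_le
  have h2 := h.M_le
  have h3 := h.three_le_ℓ
  have : 3 * n ≤ n * n := Nat.mul_le_mul_right _ (by omega)
  exact this.trans h.sq_le

/-- Split `k` as `(k - 2) + 2`: the blocks have at most `n` vertices in all, and `2 * (ℓ * r) ≤ M ≤
n`. Hence querying one pair with all blocks takes linear time. -/
theorem Setting.blocks_mul_k_le (h : Setting k ℓ r n M B) : ℓ * r * k ≤ 3 * n := by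
  have h1 := h.add_eq
  have h2 := h.ℓr_le
  have h3 := h.two_le_k
  have h4 : ℓ * r * k = ℓ * r * (k - 2) + 2 * (ℓ * r) := by
    rw [mul_comm 2, ← mul_add]; congr 1; omega
  omega

/-! ### The color of a pair together with a block -/

/-- The color of the edge `{u, v} ∪ block k M j`. -/
noncomputable def blockColor (χ : Edge n k → Fin r) (M u v j : ℕ) : ℕ :=
  edgeColor χ ({u, v} ∪ block k M j)

theorem blockColor_comm (u v j : ℕ) : blockColor χ M u v j = blockColor χ M v u j := by
  rw [blockColor, Finset.pair_comm, blockColor]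

theorem blockColor_lt (h : Setting k ℓ r n M B) {u v j : ℕ} (hu : u < M) (hv : v < M)
    (huv : u ≠ v) (hj : j < ℓ * r) : blockColor χ M u v j < r :=
  edgeColor_lt (card_pair_union_block h.two_le_k hu hv huv)
    fun _ hx => lt_of_mem_pair_union_block hu hv hj h.add_eq.le hx

/-- The number of blocks before the `j`-th that give the pair `u, v` the color `c`. -/
noncomputable def blockCount (χ : Edge n k → Fin r) (M u v c j : ℕ) : ℕ :=
  ((Finset.range j).filter fun i => blockColor χ M u v i = c).card

theorem blockCount_zero {u v c : ℕ} : blockCount χ M u v c 0 = 0 := by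
  simp [blockCount]

theorem blockCount_succ {u v c j : ℕ} : blockCount χ M u v c (j + 1) =
    blockCount χ M u v c j + if blockColor χ M u v j = c then 1 else 0 := by
  rw [blockCount, blockCount, Finset.range_add_one, Finset.filter_insert]
  split_ifs
  · rw [Finset.card_insert_of_notMem (by simp)]
  · rfl

theorem blockCount_le {u v c j : ℕ} : blockCount χ M u v c j ≤ j :=
  (Finset.card_filter_le _ _).trans (by simp)

theorem blockCount_comm (u v c j : ℕ) : blockCount χ M u v c j = blockCount χ M v u c j := by
  simp only [blockCount, blockColor_comm u v]

/-- Pigeonhole: `ℓ * r` blocks are distributed over `r` colors. -/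
theorem exists_le_blockCount (h : Setting k ℓ r n M B) {u v : ℕ} (hu : u < M) (hv : v < M)
    (huv : u ≠ v) : ∃ c < r, ℓ ≤ blockCount χ M u v c (ℓ * r) := by
  have := Finset.exists_le_card_fiber_of_mul_le_card_of_maps_to
    (s := Finset.range (ℓ * r)) (t := Finset.range r) (f := blockColor χ M u v) (n := ℓ)
    (fun j hj => Finset.mem_range.2 (blockColor_lt h hu hv huv (Finset.mem_range.1 hj)))
    (Finset.nonempty_range_iff.2 (by have := h.two_le_r; omega))
    (by rw [Finset.card_range, Finset.card_range, mul_comm])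
  obtain ⟨c, hc, hle⟩ := this
  exact ⟨c, Finset.mem_range.1 hc, hle⟩

/-- Query the edge formed by the vertices in registers `30, 31` and the block that starts at the
vertex in register `32`. The color goes to register `33`, and register `32` moves to the next
block. -/
def queryBlock : Program :=
  -- Registers `10` and `4` hold `0` and `1`, so the pair fills cells `0` and `1`; the block is
  -- written from cell `2` on.
  .seq (.store 1 10 30) <| .seq (.store 1 4 31) <| .seq (.add 40 4 4) <|
  .seq (.loop (.lt 40 0) (.seq (.store 1 40 32) (.seq (.add 40 40 4) (.add 32 32 4))))
    (.query 33 1)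

theorem wp_queryBlock (h : Setting k ℓ r n M B) (hs : Constants k ℓ r n M s) {u v j : ℕ}
    (hu : s.reg 30 = u) (hv : s.reg 31 = v) (huM : u < M) (hvM : v < M) (huv : u ≠ v)
    (hj : j < ℓ * r) (h32 : s.reg 32 = M + j * (k - 2)) :
    WP χ B queryBlock s fun t s' => t ≤ 5 * k + 4 ∧ s'.reg 33 = blockColor χ M u v j ∧
      s'.reg 32 = M + (j + 1) * (k - 2) ∧ (∀ x < 32, s'.reg x = s.reg x) ∧
      ∀ a, a ≠ 1 → s'.arr a = s.arr a := by
  have hk := h.two_le_k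
  have hkB := h.k_le
  have hend : M + (j + 1) * (k - 2) ≤ n := by
    rw [← h.add_eq]
    exact Nat.add_le_add_left (Nat.mul_le_mul_right _ hj) _
  have hnB := h.n_le
  have hsucc : (j + 1) * (k - 2) = j * (k - 2) + (k - 2) := by ring
  simp only [queryBlock, wp_seq, wp_store, wp_add]
  simp only [reg_setArr, hs.r4, hs.r10, hu, hv]
  refine ⟨by omega, ?_⟩
  refine (wp_for (k - 2) 3 (fun i s' => s'.reg 40 = i + 2 ∧ s'.reg 32 = M + j * (k - 2) + i ∧
    (∀ x < 32, s'.reg x = s.reg x) ∧ (∀ a, a ≠ 1 → s'.arr a = s.arr a) ∧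
    s'.arr 1 0 = u ∧ s'.arr 1 1 = v ∧
    ∀ i' < i, s'.arr 1 (i' + 2) = M + j * (k - 2) + i') ?_ ?_ ?_).mono ?_
  · rintro i s' - ⟨h40, -, hreg, -⟩
    rw [holds_lt, h40, hreg 0 (by omega), hs.r0]
    omega
  · rintro i s' hi ⟨h40, h32', hreg, harr, ha0, ha1, ha⟩
    have h4 := (hreg 4 (by omega)).trans hs.r4
    simp only [wp_seq, wp_store, wp_add]
    simp only [reg_setArr, reg_setReg, h40, h4, h32']
    refine ⟨by omega, by simpa using by omega, by omega, by simp, by simp; omega, ?_, ?_, ?_,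
      ?_, ?_⟩
    · intro x hx
      simp [show x ≠ 32 by omega, show x ≠ 40 by omega, hreg x hx]
    · intro a ha
      simp [ha, harr a ha]
    · simp [ha0]
    · simp [ha1]
    · intro i' hi'
      rcases Nat.lt_succ_iff_lt_or_eq.1 hi' with hi' | rfl
      · simp [hi'.ne, ha i' hi']
      · simp
  · refine ⟨by simp, by simp [h32], ?_, ?_, by simp, by simp, by omega⟩
    · intro x hx
      simp [show x ≠ 40 by omega]
    · intro a ha
      simp [ha]
  · rintro t s' ⟨ht, h40, h32', hreg, harr, ha0, ha1, ha⟩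
    refine wp_query (card_pair_union_block hk huM hvM huv)
      (fun x hx => lt_of_mem_pair_union_block huM hvM hj h.add_eq.le hx) ?_ ?_
    · ext x
      simp only [Finset.mem_image, Finset.mem_range, block, Finset.mem_union, Finset.mem_insert,
        Finset.mem_singleton, Finset.mem_Ico, hsucc]
      constructor
      · rintro ⟨i, hi, rfl⟩
        match i with
        | 0 => simp [ha0]
        | 1 => simp [ha1]
        | i + 2 =>
          rw [ha i (by omega)]
          omega
      · rintro ((rfl | rfl) | hx)
        · exact ⟨0, by omega, ha0⟩
        · exact ⟨1, by omega, ha1⟩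
        · refine ⟨x - (M + j * (k - 2)) + 2, by omega, ?_⟩
          rw [ha _ (by omega)]
          omega
    · refine ⟨by omega, by simp [blockColor], ?_, ?_, ?_⟩
      · simp [h32']
        omega
      · intro x hx
        simp [show x ≠ 33 by omega, hreg x hx]
      · intro a ha
        simp [harr a ha]

end

section

variable {n k ℓ r M B : ℕ} {s s' : Memory} {χ : Edge n k → Fin r}

/-- Put into register `15` a color that the pair in registers `30, 31` has with `ℓ` blocks. -/
def pairColor : Program :=
  -- For `k = 2` all blocks are empty and give the same edge. Running through them would exceed the
  -- constant budget per pair, so one query is made.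
  .ite (.lt 10 5)
    (.seq (.move 32 7) <| .seq (.const 14 0) <|
      .seq (.loop (.lt 14 6) <|
        .seq queryBlock <| .seq (.load 50 4 33) <| .seq (.add 50 50 4) <| .seq (.store 4 33 50) <|
        -- Counts grow by one, so a color that reaches `ℓ` is caught by testing for equality.
        .seq (.ite (.eq 50 1) (.move 15 33) .skip) (.add 14 14 4)) <|
      .seq (.const 14 0) <|
      -- The counters are cleared for the next pair.
      .loop (.lt 14 2) (.seq (.store 4 14 10) (.add 14 14 4)))
    (.seq (.move 32 7) <| .seq queryBlock (.move 15 33))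

theorem Setting.mul_ℓr_le (h : Setting k ℓ r n M B) : ℓ * r * (5 * k + 11) + 3 * r ≤ 21 * n := by
  have h1 := h.blocks_mul_k_le
  have h2 := h.ℓr_le
  have h3 := h.M_le
  have h4 := h.r_le
  have : ℓ * r * (5 * k + 11) = 5 * (ℓ * r * k) + 11 * (ℓ * r) := by ring
  omega

theorem Setting.eight_le_n (h : Setting k ℓ r n M B) : 8 ≤ n := by
  have h2 := h.ℓr_le
  have h3 := h.M_le
  have h4 := h.r_le
  have := h.two_le_r
  have := h.three_le_ℓ
  omega

/-- For `k ≥ 3` the loops take `O(n)` steps and `n ≤ n ^ (k - 2)`; for `k = 2` the time is bounded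
by a constant. -/
theorem wp_pairColor (h : Setting k ℓ r n M B) (hs : Constants k ℓ r n M s) {u v : ℕ}
    (hu : s.reg 30 = u) (hv : s.reg 31 = v) (huM : u < M) (hvM : v < M) (huv : u ≠ v)
    (h4 : ∀ c < r, s.arr 4 c = 0) :
    WP χ B pairColor s fun t s' => t ≤ 25 * n ^ (k - 2) ∧ s'.reg 15 < r ∧
      ℓ ≤ blockCount χ M u v (s'.reg 15) (ℓ * r) ∧
      (∀ x < 32, x ≠ 14 → x ≠ 15 → s'.reg x = s.reg x) ∧
      (∀ a, a ≠ 1 → a ≠ 4 → s'.arr a = s.arr a) ∧ ∀ c < r, s'.arr 4 c = 0 := by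
  have hk := h.two_le_k
  have hnB := h.n_le
  have hℓr := h.ℓr_le
  have hMn := h.M_le
  have hT := h.mul_ℓr_le
  have h8 := h.eight_le_n
  have hr := h.r_le
  have hr2 := h.two_le_r
  have h3ℓ := h.three_le_ℓ
  rw [pairColor, wp_ite]
  simp only [holds_lt, hs.r10, hs.r5]
  constructor
  · intro hk3
    have hpow : n ≤ n ^ (k - 2) := by
      calc n = n ^ 1 := (pow_one n).symm
        _ ≤ _ := Nat.pow_le_pow_right (by omega) hk3
    simp only [wp_seq, wp_move, wp_const]
    refine (wp_for (ℓ * r) (5 * k + 10) (fun j s' => s'.reg 14 = j ∧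
      s'.reg 32 = M + j * (k - 2) ∧ (∀ x < 32, x ≠ 14 → x ≠ 15 → s'.reg x = s.reg x) ∧
      (∀ a, a ≠ 1 → a ≠ 4 → s'.arr a = s.arr a) ∧
      (∀ c < r, s'.arr 4 c = blockCount χ M u v c j) ∧
      -- As soon as any color has `ℓ` blocks, register `15` holds such a color; pigeonhole shows
      -- that this happens by the end.
      ∀ c < r, ℓ ≤ blockCount χ M u v c j →
        s'.reg 15 < r ∧ ℓ ≤ blockCount χ M u v (s'.reg 15) j) ?_ ?_ ?_).mono ?_
    · rintro j s' - ⟨h14, -, hreg, -⟩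
      rw [holds_lt, h14, hreg 6 (by omega) (by omega) (by omega), hs.r6]
    · rintro j s' hj ⟨h14, h32, hreg, harr, hcnt, hbest⟩
      have hs' : Constants k ℓ r n M s' :=
        hs.congr fun x hx _ => hreg x (by omega) (by omega) (by omega)
      rw [wp_seq]
      refine (wp_queryBlock h hs' ((hreg 30 (by omega) (by omega) (by omega)).trans hu)
        ((hreg 31 (by omega) (by omega) (by omega)).trans hv) huM hvM huv hj h32).mono ?_
      rintro t s'' ⟨ht, h33, h32'', hreg'', harr''⟩
      have hs'' : Constants k ℓ r n M s'' := hs'.congr fun x hx _ => hreg'' x (by omega)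
      have hc0 := blockColor_lt (χ := χ) h huM hvM huv hj
      set c₀ := blockColor χ M u v j with hc₀
      have hc4 : s''.arr 4 c₀ = blockCount χ M u v c₀ j := by
        rw [harr'' 4 (by omega), hcnt c₀ hc0]
      have h14'' : s''.reg 14 = j := (hreg'' 14 (by omega)).trans h14
      have hle := blockCount_le (χ := χ) (M := M) (u := u) (v := v) (c := c₀) (j := j)
      have hc1 : blockCount χ M u v c₀ (j + 1) = blockCount χ M u v c₀ j + 1 := by
        rw [blockCount_succ, if_pos rfl]
      have hne : ∀ c, c ≠ c₀ → blockCount χ M u v c (j + 1) = blockCount χ M u v c j := by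
        intro c hc
        rw [blockCount_succ, if_neg (by rw [← hc₀]; exact hc.symm), add_zero]
      have hmono : ∀ c, blockCount χ M u v c j ≤ blockCount χ M u v c (j + 1) := by
        intro c
        rw [blockCount_succ]
        exact Nat.le_add_right _ _
      simp only [wp_seq, wp_load, wp_add, wp_store, wp_ite, wp_move, wp_skip, holds_eq]
      simp [h33, hs''.r4, hs''.r1, hc4, h14'']
      refine ⟨by omega, fun heq => ⟨by omega, by omega, h32'', ?_, ?_, ?_, ?_⟩,
        fun heq => ⟨by omega, by omega, h32'', ?_, ?_, ?_, ?_⟩⟩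
      · intro x hx hx14 hx15
        simp [hx14, hx15, show x ≠ 50 by omega, hreg'' x hx, hreg x hx hx14 hx15]
      · intro a ha1 ha4
        simp [ha4, harr'' a ha1, harr a ha1 ha4]
      · intro c hc
        by_cases hcc : c = c₀
        · rw [hcc, Function.update_self, hc1]
        · rw [Function.update_of_ne hcc, harr'' 4 (by omega), hcnt c hc, hne c hcc]
      · intro c hc hcℓ
        exact ⟨hc0, by omega⟩
      · intro x hx hx14 hx15
        simp [hx14, show x ≠ 50 by omega, hreg'' x hx, hreg x hx hx14 hx15]
      · intro a ha1 ha4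
        simp [ha4, harr'' a ha1, harr a ha1 ha4]
      · intro c hc
        by_cases hcc : c = c₀
        · rw [hcc, Function.update_self, hc1]
        · rw [Function.update_of_ne hcc, harr'' 4 (by omega), hcnt c hc, hne c hcc]
      · intro c hc hcℓ
        rw [hreg'' 15 (by omega)]
        have hold : ℓ ≤ blockCount χ M u v c j := by
          by_cases hcc : c = c₀
          · rw [hcc] at hcℓ ⊢
            omega
          · rwa [hne c hcc] at hcℓ
        exact ⟨(hbest c hc hold).1, (hbest c hc hold).2.trans (hmono _)⟩
    · refine ⟨by simp, by simp [hs.r7], ?_, fun a _ _ => rfl, ?_, ?_⟩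
      · intro x hx hx14 _
        simp [hx14, show x ≠ 32 by omega]
      · intro c hc
        simpa [blockCount_zero] using h4 c hc
      · intro c hc hcℓ
        rw [blockCount_zero] at hcℓ
        omega
    · rintro t s' ⟨ht, -, -, hreg, harr, -, hbest⟩
      have hs' : Constants k ℓ r n M s' :=
        hs.congr fun x hx _ => hreg x (by omega) (by omega) (by omega)
      obtain ⟨c, hc, hcℓ⟩ := exists_le_blockCount (χ := χ) h huM hvM huv
      obtain ⟨h15, hgood⟩ := hbest c hc hcℓ
      refine (wp_for r 2 (fun j s'' => s''.reg 14 = j ∧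
        (∀ x, x ≠ 14 → s''.reg x = s'.reg x) ∧ (∀ a, a ≠ 4 → s''.arr a = s'.arr a) ∧
        ∀ c < j, s''.arr 4 c = 0) ?_ ?_ ?_).mono ?_
      · rintro j s'' - ⟨h14, hreg'', -⟩
        rw [holds_lt, h14, hreg'' 2 (by omega), hs'.r2]
      · rintro j s'' hj ⟨h14, hreg'', harr'', hzero⟩
        simp only [wp_seq, wp_store, wp_add]
        simp [hreg'', hs'.r4, hs'.r10, h14]
        refine ⟨by omega, fun x hx => by simp [hx, hreg'' x hx], fun a ha => by simp [ha, harr''],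
          ?_⟩
        intro c hc
        rcases Nat.lt_or_eq_of_le hc with hc | rfl
        · simp [hc.ne, hzero c hc]
        · simp
      · exact ⟨by simp, fun x hx => by simp [hx], fun _ _ => rfl, by omega⟩
      · rintro t' s'' ⟨ht', -, hreg'', harr'', hzero⟩
        rw [hreg'' 15 (by omega)]
        have e1 : ℓ * r * (5 * k + 10 + 1) = ℓ * r * (5 * k + 11) := by ring
        refine ⟨by omega, h15, hgood, ?_, ?_, hzero⟩
        · intro x hx hx14 hx15
          rw [hreg'' x hx14, hreg x hx hx14 hx15]
        · intro a ha1 ha4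
          rw [harr'' a ha4, harr a ha1 ha4]
  · intro hk2
    have hk2 : k = 2 := by omega
    simp only [wp_seq, wp_move]
    have hs' : Constants k ℓ r n M (s.setReg 32 (s.reg 7)) :=
      hs.congr fun x hx _ => by simp [show x ≠ 32 by omega]
    refine (wp_queryBlock h hs' (by simpa using hu) (by simpa using hv) huM hvM huv
      (show 0 < ℓ * r by omega) (by simp [hs.r7])).mono ?_
    rintro t s' ⟨ht, h33, -, hreg, harr⟩
    simp only [reg_setReg, if_pos, h33, arr_setReg]
    have hconst : ∀ j, blockColor χ M u v j = blockColor χ M u v 0 := by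
      intro j
      simp [blockColor, block, hk2]
    refine ⟨?_, blockColor_lt h huM hvM huv (by omega), ?_, ?_, ?_, ?_⟩
    · have : n ^ (k - 2) = 1 := by rw [hk2]; rfl
      rw [this]
      omega
    · simp only [blockCount, hconst, Finset.filter_true, Finset.card_range]
      exact Nat.le_mul_of_pos_right _ (by omega)
    · intro x hx hx14 hx15
      rw [if_neg hx15, hreg x hx]
      simp [show x ≠ 32 by omega]
    · intro a ha1 ha4
      rw [harr a ha1]
      rfl
    · intro c hc
      rw [harr 4 (by omega)]
      exact h4 c hc

/-! ### Preparation -/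

/-- Compute the constants and the multiples of `M`. -/
def setUp : Program :=
  .seq (.const 4 1) <| .seq (.sub 5 0 4) <| .seq (.sub 5 5 4) <|
  -- The machine cannot multiply, so all products arise by repeated addition or subtraction.
  .seq (.const 11 0) <| .seq (.loop (.lt 11 2) (.seq (.add 6 6 1) (.add 11 11 4))) <|
  .seq (.move 7 3) <| .seq (.const 11 0) <|
  .seq (.loop (.lt 11 6) (.seq (.sub 7 7 5) (.add 11 11 4))) <|
  .seq (.const 11 0) <| .seq (.loop (.lt 11 1) (.seq (.add 8 8 7) (.add 11 11 4))) <|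
  .seq (.const 11 0) <|
  -- The table of multiples lets the cell `a * M + b` of a pair be addressed in constant time.
  .loop (.lt 11 7) (.seq (.store 2 11 13) (.seq (.add 13 13 7) (.add 11 11 4)))

/-- Keeps the addresses of pairs within the limit on sums. -/
theorem Setting.mul_M_le (h : Setting k ℓ r n M B) {i : ℕ} (hi : i ≤ M) : i * M ≤ B :=
  (Nat.mul_le_mul (hi.trans h.M_le) h.M_le).trans h.sq_le

theorem wp_setUp (h : Setting k ℓ r n M B) :
    WP χ B setUp (input k ℓ r n) fun t s' => t ≤ 20 * n ∧ Constants k ℓ r n M s' ∧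
      (∀ u < M, s'.arr 2 u = u * M) ∧ ∀ a, a ≠ 2 → ∀ i, s'.arr a i = 0 := by
  have hnB := h.n_le
  have hℓr := h.ℓr_le
  have hMn := h.M_le
  have h8 := h.eight_le_n
  have hr := h.r_le
  have hr2 := h.two_le_r
  have h3ℓ := h.three_le_ℓ
  have hadd := h.add_eq
  simp only [setUp, wp_seq, wp_const, wp_sub, wp_move]
  refine (wp_for r 2 (fun i s => s.reg 6 = ℓ * i ∧ s.reg 11 = i ∧ s.reg 0 = k ∧ s.reg 1 = ℓ ∧
    s.reg 2 = r ∧ s.reg 3 = n ∧ s.reg 4 = 1 ∧ s.reg 5 = k - 2 ∧ s.reg 8 = 0 ∧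
    s.reg 10 = 0 ∧ s.reg 13 = 0 ∧ ∀ a i, s.arr a i = 0) ?_ ?_ ?_).mono ?_
  · rintro i s - hs
    simp [hs]
  · rintro i s hi hs
    have : ℓ * (i + 1) ≤ ℓ * r := Nat.mul_le_mul_left _ hi
    have : ℓ * (i + 1) = ℓ * i + ℓ := by ring
    simp only [wp_seq, wp_add]
    simp [hs]
    omega
  · simp [input]
    omega
  rintro t₁ s₁ ⟨ht₁, hs₁⟩
  refine (wp_for (ℓ * r) 2 (fun i s => s.reg 6 = ℓ * r ∧ s.reg 7 = n - i * (k - 2) ∧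
    s.reg 11 = i ∧ s.reg 0 = k ∧ s.reg 1 = ℓ ∧
    s.reg 2 = r ∧ s.reg 3 = n ∧ s.reg 4 = 1 ∧ s.reg 5 = k - 2 ∧ s.reg 8 = 0 ∧
    s.reg 10 = 0 ∧ s.reg 13 = 0 ∧ ∀ a i, s.arr a i = 0) ?_ ?_ ?_).mono ?_
  · rintro i s - hs
    simp [hs]
  · rintro i s hi hs
    have : (i + 1) * (k - 2) = i * (k - 2) + (k - 2) := by ring
    simp only [wp_seq, wp_add, wp_sub]
    simp [hs]
    omega
  · simp [hs₁]
  rintro t₂ s₂ ⟨ht₂, hs₂⟩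
  have h7 : s₂.reg 7 = M := by rw [hs₂.2.1]; omega
  refine (wp_for ℓ 2 (fun i s => s.reg 6 = ℓ * r ∧ s.reg 7 = M ∧
    s.reg 11 = i ∧ s.reg 0 = k ∧ s.reg 1 = ℓ ∧
    s.reg 2 = r ∧ s.reg 3 = n ∧ s.reg 4 = 1 ∧ s.reg 5 = k - 2 ∧ s.reg 8 = i * M ∧
    s.reg 10 = 0 ∧ s.reg 13 = 0 ∧ ∀ a i, s.arr a i = 0) ?_ ?_ ?_).mono ?_
  · rintro i s - hs
    simp [hs]
  · rintro i s hi hs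
    have := h.mul_M_le (show i + 1 ≤ M by omega)
    have : (i + 1) * M = i * M + M := by ring
    simp only [wp_seq, wp_add]
    simp [hs]
    omega
  · simp [hs₂]
    omega
  rintro t₃ s₃ ⟨ht₃, hs₃⟩
  refine (wp_for M 3 (fun i s => s.reg 6 = ℓ * r ∧ s.reg 7 = M ∧
    s.reg 11 = i ∧ s.reg 0 = k ∧ s.reg 1 = ℓ ∧
    s.reg 2 = r ∧ s.reg 3 = n ∧ s.reg 4 = 1 ∧ s.reg 5 = k - 2 ∧ s.reg 8 = ℓ * M ∧
    s.reg 10 = 0 ∧ s.reg 13 = i * M ∧ (∀ u < i, s.arr 2 u = u * M) ∧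
    ∀ a, a ≠ 2 → ∀ i, s.arr a i = 0) ?_ ?_ ?_).mono ?_
  · rintro i s - hs
    simp [hs]
  · rintro i s hi hs
    have := h.mul_M_le (show i + 1 ≤ M by omega)
    have : (i + 1) * M = i * M + M := by ring
    simp only [wp_seq, wp_add, wp_store]
    simp [hs]
    refine ⟨by omega, by omega, by omega, ?_, ?_⟩
    · intro u hu
      rcases Nat.lt_or_eq_of_le hu with hu | rfl
      · simp [hu.ne, hs.2.2.2.2.2.2.2.2.2.2.2.2.1 u hu]
      · simp
    · intro a ha i
      simp [ha, hs.2.2.2.2.2.2.2.2.2.2.2.2.2 a ha i]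
  · simp [hs₃]
  rintro t₄ s₄ ⟨ht₄, h6, h7, -, h0, h1, h2, h3, h4, h5, h8, h10, -, hmul, hzero⟩
  exact ⟨by omega, ⟨h0, h1, h2, h3, h4, h5, h6, h7, h8, h10⟩, hmul, hzero⟩

end

section

variable {n k ℓ r M B : ℕ} {s s' : Memory} {χ : Edge n k → Fin r}

/-! ### Coloring all pairs -/

/-- Color the pair of the vertices in registers `11` and `12`, record its color, and move on to the
next vertex in register `12`. -/
def colorPair : Program :=
  .seq (.move 30 11) <| .seq (.move 31 12) <| .seq pairColor <|
  .seq (.add 50 13 12) <| .seq (.store 3 50 15) <|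
  .seq (.load 51 2 12) <| .seq (.add 51 51 11) <| .seq (.store 3 51 15) <|
  -- A color is chosen when its count equals `ℓ * M`; since counts only grow, it stays a valid
  -- choice.
  .seq (.load 52 5 15) <| .seq (.add 52 52 4) <| .seq (.store 5 15 52) <|
  .seq (.ite (.eq 52 8) (.move 9 15) .skip) (.add 12 12 4)

/-- Color all pairs, count the pairs of each color, and choose a color with many pairs. -/
def colorPairs : Program :=
  .seq (.const 11 0) <| .loop (.lt 11 7) <|
    .seq (.load 13 2 11) <| .seq (.const 12 0) <|
    .seq (.loop (.lt 12 11) colorPair) (.add 11 11 4)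

/-- The pairs `b < a < M` that precede `(u, v)` in the lexicographic order. -/
def pairsBefore (M u v : ℕ) : Finset (ℕ × ℕ) :=
  (Finset.range M ×ˢ Finset.range M).filter fun x => x.2 < x.1 ∧ (x.1 < u ∨ x.1 = u ∧ x.2 < v)

theorem pairsBefore_succ {u v : ℕ} (hu : u < M) (hv : v < u) :
    pairsBefore M u (v + 1) = insert (u, v) (pairsBefore M u v) := by
  ext ⟨a, b⟩
  simp only [pairsBefore, Finset.mem_filter, Finset.mem_product, Finset.mem_range,
    Finset.mem_insert, Prod.mk.injEq]
  omega

theorem pairsBefore_self {u : ℕ} : pairsBefore M u u = pairsBefore M (u + 1) 0 := by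
  ext ⟨a, b⟩
  simp only [pairsBefore, Finset.mem_filter, Finset.mem_product, Finset.mem_range]
  omega

/-- Division with remainder by `M`: different ordered pairs have different cells. -/
theorem index_injective {a b u v : ℕ} (hb : b < M) (hv : v < M) (h : a * M + b = u * M + v) :
    a = u ∧ b = v := by
  have h1 : a = u := by
    have := congrArg (· / M) h
    simpa [Nat.add_div_of_dvd_right, Nat.mul_div_cancel _ (show 0 < M by omega),
      Nat.div_eq_of_lt hb, Nat.div_eq_of_lt hv] using this
  subst h1
  exact ⟨rfl, by omega⟩

/-- In the memory `s` all pairs before `(u, v)` have been colored. -/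
structure IsPairColored (ℓ M : ℕ) (χ : Edge n k → Fin r) (u v : ℕ) (s : Memory) : Prop where
  constants : Constants k ℓ r n M s
  multiples : ∀ a < M, s.arr 2 a = a * M
  symm : ∀ x ∈ pairsBefore M u v, s.arr 3 (x.2 * M + x.1) = s.arr 3 (x.1 * M + x.2)
  lt : ∀ x ∈ pairsBefore M u v, s.arr 3 (x.1 * M + x.2) < r
  good : ∀ x ∈ pairsBefore M u v,
    ℓ ≤ blockCount χ M x.1 x.2 (s.arr 3 (x.1 * M + x.2)) (ℓ * r)
  counts_zero : ∀ c < r, s.arr 4 c = 0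
  counts : ∀ c, s.arr 5 c =
    ((pairsBefore M u v).filter fun x => s.arr 3 (x.1 * M + x.2) = c).card
  best : ∀ c, ℓ * M ≤ s.arr 5 c → ℓ * M ≤ s.arr 5 (s.reg 9)
  rest : ∀ a, a = 0 ∨ 6 ≤ a → ∀ i, s.arr a i = 0

theorem wp_colorPair (h : Setting k ℓ r n M B) {u v : ℕ} (hs : IsPairColored ℓ M χ u v s)
    (hu : u < M) (hv : v < u) (h11 : s.reg 11 = u) (h12 : s.reg 12 = v)
    (h13 : s.reg 13 = u * M) :
    WP χ B colorPair s fun t s' => t ≤ 25 * n ^ (k - 2) + 13 ∧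
      IsPairColored ℓ M χ u (v + 1) s' ∧ s'.reg 11 = u ∧ s'.reg 12 = v + 1 ∧
      s'.reg 13 = u * M := by
  have hvM : v < M := hv.trans hu
  have hnB := h.n_le
  have hMn := h.M_le
  simp only [colorPair, wp_seq, wp_move]
  refine (wp_pairColor (u := u) (v := v) h (hs.constants.congr ?_) ?_ ?_ hu hvM hv.ne' ?_).mono ?_
  · intro x hx _
    simp [show x ≠ 30 by omega, show x ≠ 31 by omega]
  · simp [h11]
  · simp [h12]
  · simpa using hs.counts_zero
  rintro t s' ⟨ht, h15r, hgood, hreg, harr, hzero⟩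
  have hreg' : ∀ x < 30, x ≠ 14 → x ≠ 15 → s'.reg x = s.reg x := by
    intro x hx hx14 hx15
    rw [hreg x (by omega) hx14 hx15]
    simp [show x ≠ 30 by omega, show x ≠ 31 by omega]
  have harr' : ∀ a, a ≠ 1 → a ≠ 4 → s'.arr a = s.arr a := harr
  have hs' : Constants k ℓ r n M s' :=
    hs.constants.congr fun x hx _ => hreg' x (by omega) (by omega) (by omega)
  have h11' := (hreg' 11 (by omega) (by omega) (by omega)).trans h11
  have h12' := (hreg' 12 (by omega) (by omega) (by omega)).trans h12
  have h13' := (hreg' 13 (by omega) (by omega) (by omega)).trans h13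
  have h2' : s'.arr 2 v = v * M := by
    rw [harr' 2 (by omega) (by omega)]
    exact hs.multiples v hvM
  have h5' := harr' 5 (by omega) (by omega)
  have h3' := harr' 3 (by omega) (by omega)
  set c₀ := s'.reg 15 with hc₀
  set f := s.arr 3 with hf
  set f' := Function.update (Function.update f (u * M + v) c₀) (v * M + u) c₀ with hf'
  -- Only the cells of `(u, v)` and `(v, u)` change, and no earlier pair uses them in either order.
  have hold : ∀ x ∈ pairsBefore M u v, f' (x.1 * M + x.2) = f (x.1 * M + x.2) ∧
      f' (x.2 * M + x.1) = f (x.2 * M + x.1) := by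
    rintro ⟨a, b⟩ hx
    simp only [pairsBefore, Finset.mem_filter, Finset.mem_product, Finset.mem_range] at hx
    constructor
    · rw [hf', Function.update_of_ne, Function.update_of_ne]
      · intro he
        have := index_injective (by omega) (by omega) he
        omega
      · intro he
        have := index_injective (by omega) (by omega) he
        omega
    · rw [hf', Function.update_of_ne, Function.update_of_ne]
      · intro he
        have := index_injective (by omega) (by omega) he
        omega
      · intro he
        have := index_injective (by omega) (by omega) he
        omega
  have hnew₂ : f' (v * M + u) = c₀ := by rw [hf', Function.update_self]
  have hnew₁ : f' (u * M + v) = c₀ := by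
    rw [hf', Function.update_of_ne, Function.update_self]
    intro he
    have := index_injective (by omega) (by omega) he
    omega
  have hnotMem : (u, v) ∉ pairsBefore M u v := by simp [pairsBefore]
  have hcounts : ∀ c, ((pairsBefore M u (v + 1)).filter fun x => f' (x.1 * M + x.2) = c).card =
      s.arr 5 c + if c = c₀ then 1 else 0 := by
    intro c
    have hcongr : (pairsBefore M u v).filter (fun x => f' (x.1 * M + x.2) = c) =
        (pairsBefore M u v).filter (fun x => f (x.1 * M + x.2) = c) :=
      Finset.filter_congr fun x hx => by rw [(hold x hx).1]
    rw [hs.counts c, pairsBefore_succ hu hv, Finset.filter_insert, hnew₁, hcongr]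
    by_cases hc : c = c₀
    · rw [if_pos hc.symm, if_pos hc, Finset.card_insert_of_notMem]
      exact fun hmem => hnotMem (Finset.mem_filter.1 hmem).1
    · rw [if_neg (Ne.symm hc), if_neg hc, add_zero]
  -- A count never exceeds the `M * M` ordered pairs, so incrementing it does not block.
  have hcountB : s.arr 5 c₀ + 1 ≤ B := by
    have h1 := hcounts c₀
    rw [if_pos rfl] at h1
    rw [← h1]
    calc _ ≤ _ := Finset.card_filter_le _ _
      _ ≤ _ := Finset.card_filter_le _ _
      _ = M * M := by simp
      _ ≤ B := h.mul_M_le le_rfl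
  have hu1 := h.mul_M_le (show u + 1 ≤ M by omega)
  have hv1 := h.mul_M_le (show v + 1 ≤ M by omega)
  rw [add_mul, one_mul] at hu1 hv1
  -- Both outcomes of the final test lead to memories of this shape.
  have main : ∀ s'' : Memory, (∀ x < 14, x ≠ 9 → x ≠ 12 → s''.reg x = s'.reg x) →
      (∀ a, a ≠ 3 → a ≠ 5 → s''.arr a = s'.arr a) → s''.arr 3 = f' →
      s''.arr 5 = Function.update (s.arr 5) c₀ (s.arr 5 c₀ + 1) →
      (s''.reg 9 = if s.arr 5 c₀ + 1 = ℓ * M then c₀ else s.reg 9) →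
      IsPairColored ℓ M χ u (v + 1) s'' := by
    intro s'' hreg'' harr'' h3'' h5'' h9''
    have hc5 : ∀ c, s''.arr 5 c = s.arr 5 c + if c = c₀ then 1 else 0 := by
      intro c
      rw [h5'', Function.update_apply]
      split_ifs with hc
      · rw [hc]
      · rfl
    have hmem : ∀ x ∈ pairsBefore M u (v + 1), x = (u, v) ∨ x ∈ pairsBefore M u v := by
      intro x hx
      rw [pairsBefore_succ hu hv] at hx
      exact Finset.mem_insert.1 hx
    refine ⟨hs'.congr fun x hx hx9 => hreg'' x (by omega) hx9 (by omega), ?_, ?_, ?_, ?_, ?_, ?_,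
      ?_, ?_⟩
    · intro a ha
      rw [harr'' 2 (by omega) (by omega), harr' 2 (by omega) (by omega)]
      exact hs.multiples a ha
    · intro x hx
      rw [h3'']
      rcases hmem x hx with rfl | hx
      · rw [hnew₁, hnew₂]
      · rw [(hold x hx).1, (hold x hx).2]
        exact hs.symm x hx
    · intro x hx
      rw [h3'']
      rcases hmem x hx with rfl | hx
      · rwa [hnew₁]
      · rw [(hold x hx).1]
        exact hs.lt x hx
    · intro x hx
      rw [h3'']
      rcases hmem x hx with rfl | hx
      · rwa [hnew₁]
      · rw [(hold x hx).1]
        exact hs.good x hx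
    · intro c hc
      rw [harr'' 4 (by omega) (by omega)]
      exact hzero c hc
    · intro c
      rw [h3'', hcounts c, hc5]
    · intro c hc
      rw [h9'', hc5]
      have hbest := hs.best
      by_cases heq : s.arr 5 c₀ + 1 = ℓ * M
      · simp only [if_pos heq, if_true]
        omega
      · rw [if_neg heq]
        refine le_trans (hbest c ?_) (Nat.le_add_right _ _)
        rw [hc5] at hc
        split_ifs at hc with hcc
        · subst hcc
          omega
        · exact hc
    · intro a ha i
      rw [harr'' a (by omega) (by omega), harr' a (by omega) (by omega)]
      exact hs.rest a ha i
  simp only [wp_load, wp_add, wp_store, wp_ite, wp_move, wp_skip, holds_eq]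
  simp [h11', h12', h13', hs'.r4, hs'.r8, h2', h5', ← hc₀]
  refine ⟨by omega, by omega, hcountB, fun heq => ⟨by omega, by omega, ?_⟩,
    fun heq => ⟨by omega, by omega, ?_⟩⟩
  · refine main _ ?_ ?_ ?_ ?_ ?_
    · intro x hx hx9 hx12
      simp [hx9, hx12, show x ≠ 50 by omega, show x ≠ 51 by omega, show x ≠ 52 by omega]
    · intro a ha3 ha5
      simp [ha3, ha5]
    · simp [h3', hf']
    · simp [h5']
    · simp [heq]
  · refine main _ ?_ ?_ ?_ ?_ ?_
    · intro x hx hx9 hx12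
      simp [hx12, show x ≠ 50 by omega, show x ≠ 51 by omega, show x ≠ 52 by omega]
    · intro a ha3 ha5
      simp [ha3, ha5]
    · simp [h3', hf']
    · simp [h5']
    · simp [heq, hreg' 9]

theorem IsPairColored.congr {u v u' v' : ℕ} (hs : IsPairColored ℓ M χ u v s)
    (hp : pairsBefore M u v = pairsBefore M u' v') (hreg : ∀ x < 11, s'.reg x = s.reg x)
    (harr : s'.arr = s.arr) : IsPairColored ℓ M χ u' v' s' where
  constants := hs.constants.congr fun x hx _ => hreg x hx
  multiples := by rw [harr]; exact hs.multiples
  symm := by rw [harr, ← hp]; exact hs.symm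
  lt := by rw [harr, ← hp]; exact hs.lt
  good := by rw [harr, ← hp]; exact hs.good
  counts_zero := by rw [harr]; exact hs.counts_zero
  counts := by rw [harr, ← hp]; exact hs.counts
  best := by rw [harr, hreg 9 (by omega)]; exact hs.best
  rest := by rw [harr]; exact hs.rest

/-- In the memory `s` all pairs have been colored and a frequent color has been chosen. -/
structure IsColored (ℓ M : ℕ) (χ : Edge n k → Fin r) (s : Memory) : Prop where
  constants : Constants k ℓ r n M s
  multiples : ∀ a < M, s.arr 2 a = a * M
  symm : ∀ a b, b < a → a < M → s.arr 3 (b * M + a) = s.arr 3 (a * M + b)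
  good : ∀ a < M, ∀ b < M, a ≠ b → ℓ ≤ blockCount χ M a b (s.arr 3 (a * M + b)) (ℓ * r)
  many : ℓ * M ≤ (edgePairs (fun a b => s.arr 3 (a * M + b) = s.reg 9) M).card
  rest : ∀ a, a = 0 ∨ 6 ≤ a → ∀ i, s.arr a i = 0

/-- Once all pairs are colored, some color has reached `ℓ * M`, so `best` applies to the color in
register `9`. -/
theorem IsPairColored.isColored (h : Setting k ℓ r n M B) (hs : IsPairColored ℓ M χ M 0 s) :
    IsColored ℓ M χ s := by
  have hmem : ∀ a b, b < a → a < M → (a, b) ∈ pairsBefore M M 0 := by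
    intro a b hb ha
    simp only [pairsBefore, Finset.mem_filter, Finset.mem_product, Finset.mem_range]
    omega
  have hsymm : ∀ a b, b < a → a < M → s.arr 3 (b * M + a) = s.arr 3 (a * M + b) :=
    fun a b hb ha => hs.symm (a, b) (hmem a b hb ha)
  have hcounts : ∀ c, s.arr 5 c = (edgePairs (fun a b => s.arr 3 (a * M + b) = c) M).card := by
    intro c
    rw [hs.counts c]
    congr 1
    ext ⟨a, b⟩
    simp only [pairsBefore, edgePairs, Finset.mem_filter, Finset.mem_product, Finset.mem_range]
    omega
  refine ⟨hs.constants, hs.multiples, hsymm, ?_, ?_, hs.rest⟩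
  · intro a ha b hb hab
    rcases Nat.lt_or_gt_of_ne hab with hlt | hlt
    · rw [hsymm b a hlt hb, blockCount_comm]
      exact hs.good (b, a) (hmem b a hlt hb)
    · exact hs.good (a, b) (hmem a b hlt ha)
  · have hℓ : 1 ≤ ℓ := by have := h.three_le_ℓ; omega
    obtain ⟨c, -, hc⟩ := exists_large_colorClass (r := r) hℓ h.pow_le
      (fun a b => s.arr 3 (a * M + b)) fun a b hb ha => hs.lt (a, b) (hmem a b hb ha)
    have hbest := hs.best c (by rw [hcounts]; exact hc)
    rwa [hcounts] at hbest

theorem wp_colorPairs (h : Setting k ℓ r n M B) (hs : Constants k ℓ r n M s)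
    (h2 : ∀ a < M, s.arr 2 a = a * M) (h0 : ∀ a, a ≠ 2 → ∀ i, s.arr a i = 0) :
    WP χ B colorPairs s fun t s' => t ≤ 60 * (n * n * n ^ (k - 2)) ∧ IsColored ℓ M χ s' := by
  have hnB := h.n_le
  have hMn := h.M_le
  have h8 := h.eight_le_n
  have hMpos : 0 < ℓ * M := by
    have := h.three_le_ℓ
    have := h.ℓr_le
    exact Nat.mul_pos (by omega) (by omega)
  set P := n ^ (k - 2) with hP
  have hP1 : 1 ≤ P := Nat.one_le_pow _ _ (by omega)
  simp only [colorPairs, wp_seq, wp_const]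
  refine (wp_for M (M * (25 * P + 14) + 4) (fun u s' => s'.reg 11 = u ∧
    IsPairColored ℓ M χ u 0 s') ?_ ?_ ?_).mono ?_
  · rintro u s' - ⟨h11, hs'⟩
    rw [holds_lt, h11, hs'.constants.r7]
  · rintro u s₁ hu ⟨h11, hs₁⟩
    simp only [wp_seq, wp_load, wp_const]
    refine (wp_for u (25 * P + 13) (fun v s' => IsPairColored ℓ M χ u v s' ∧
      s'.reg 11 = u ∧ s'.reg 12 = v ∧ s'.reg 13 = u * M) ?_ ?_ ?_).mono ?_
    · rintro v s' - ⟨-, h11', h12', -⟩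
      rw [holds_lt, h11', h12']
    · rintro v s' hv ⟨hs', h11', h12', h13'⟩
      exact wp_colorPair h hs' hu hv h11' h12' h13'
    · refine ⟨hs₁.congr rfl ?_ rfl, by simp [h11], by simp, by simp [h11, hs₁.multiples u hu]⟩
      intro x hx
      simp [show x ≠ 12 by omega, show x ≠ 13 by omega]
    · rintro t s' ⟨ht, hs', h11', h12', -⟩
      have : u * (25 * P + 13 + 1) ≤ M * (25 * P + 14) := Nat.mul_le_mul_right _ hu.le
      simp only [wp_add]
      simp [h11', hs'.constants.r4]
      refine ⟨by omega, by omega, hs'.congr pairsBefore_self ?_ rfl⟩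
      intro x hx
      simp [show x ≠ 11 by omega]
  · refine ⟨by simp, hs.congr ?_, by simpa using h2, ?_, ?_, ?_, ?_, ?_, ?_, ?_⟩
    · intro x hx _
      simp [show x ≠ 11 by omega]
    · intro x hx
      simp [pairsBefore] at hx
    · intro x hx
      simp [pairsBefore] at hx
    · intro x hx
      simp [pairsBefore] at hx
    · exact fun c _ => h0 4 (by omega) c
    · intro c
      rw [arr_setReg, h0 5 (by omega)]
      simp [pairsBefore]
    · intro c hc
      rw [arr_setReg, h0 5 (by omega)] at hc
      omega
    · exact fun a ha i => h0 a (by omega) i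
  · rintro t s' ⟨ht, -, hs'⟩
    refine ⟨?_, hs'.isColored h⟩
    have h1 : M * (M * (25 * P + 14) + 4 + 1) ≤ n * (n * (39 * P) + n * P) := by
      refine Nat.mul_le_mul hMn ?_
      have h2 : M * (25 * P + 14) ≤ n * (39 * P) := Nat.mul_le_mul hMn (by omega)
      have h3 : n * 1 ≤ n * P := Nat.mul_le_mul_left _ hP1
      omega
    have h2 : n * (n * (39 * P) + n * P) = 40 * (n * n * P) := by ring
    have h3 : 8 * 8 * 1 ≤ n * n * P := Nat.mul_le_mul (Nat.mul_le_mul h8 h8) hP1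
    omega

end

section

variable {n k ℓ r M B : ℕ} {s s' : Memory} {χ : Edge n k → Fin r}

/-! ### The search for a path -/

/-- One step of the depth first search: look for an unvisited neighbor of the last vertex of the
path, append it to the path if there is one, and delete the last vertex otherwise. The first entry
of the path stands for a root that is adjacent to all vertices. -/
def searchStep : Program :=
  .seq (.sub 22 20 4) <| .seq (.load 23 7 22) <| .seq (.load 24 2 23) <| .seq (.move 25 7) <|
  .seq (.const 26 0) <|
  .seq (.loop (.lt 26 7) <|
    .seq (.add 27 24 26) <| .seq (.load 27 3 27) <|
    -- At the root the color just loaded is replaced by the chosen one, which makes every vertex a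
    -- neighbor.
    .seq (.ite (.eq 20 4) (.move 27 9) .skip) <|
    .seq (.ite (.eq 27 9) (.seq (.load 28 6 26) (.ite (.eq 28 10) (.move 25 26) .skip)) .skip)
      (.add 26 26 4)) <|
  .ite (.lt 25 7) (.seq (.store 7 20 25) (.seq (.store 6 25 4) (.add 20 20 4))) (.sub 20 20 4)

/-- Find a path with `ℓ` edges in the graph of the chosen color. -/
def search : Program :=
  -- The target `ℓ + 2` for `m` means `ℓ + 1` vertices on the path.
  .seq (.const 20 1) <| .seq (.add 21 1 4) <| .seq (.add 21 21 4) <|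
  .loop (.lt 20 21) searchStep

/-- The pairs whose recorded color is the chosen one. -/
def chosen (M : ℕ) (s : Memory) (a b : ℕ) : Prop := s.arr 3 (a * M + b) = s.reg 9

instance (M : ℕ) (s : Memory) : DecidableRel (chosen M s) :=
  fun _ _ => inferInstanceAs (Decidable (_ = _))

/-- The vertices marked as visited. -/
def visitedSet (M : ℕ) (s : Memory) : Finset ℕ := (Finset.range M).filter fun v => s.arr 6 v ≠ 0

theorem mem_visitedSet {v : ℕ} (hv : v < M) : v ∈ visitedSet M s ↔ s.arr 6 v ≠ 0 := by
  simp [visitedSet, hv]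

/-- The search that started in the memory `s₀` has reached the memory `s` with `m - 1` vertices on
the path and at most `(i - m) / 2` unvisited vertices. -/
structure IsSearching (ℓ M : ℕ) (s₀ : Memory) (i : ℕ) (s : Memory) : Prop where
  reg : ∀ x < 11, s.reg x = s₀.reg x
  r21 : s.reg 21 = ℓ + 2
  arr : ∀ a, a ≠ 6 → a ≠ 7 → s.arr a = s₀.arr a
  root : s.arr 7 0 = 0
  le : s.reg 20 ≤ ℓ + 2
  -- The potential is `m` plus twice the number of unvisited vertices. Appending changes it by `1 -
  -- 2`, deleting by `-1`, so each step lowers it by one.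
  measure : 2 * M + s.reg 20 ≤ i + 2 * (visitedSet M s).card
  state : ∃ D, IsSearchState (chosen M s₀) M ℓ (s.reg 20) (s.arr 7) (visitedSet M s) D

theorem visitedSet_card_le : (visitedSet M s).card ≤ M :=
  (Finset.card_filter_le _ _).trans (by simp)

theorem wp_searchStep (h : Setting k ℓ r n M B) {s₀ : Memory} (hs₀ : IsColored ℓ M χ s₀) {i : ℕ}
    (hs : IsSearching ℓ M s₀ i s) (hlt : s.reg 20 < ℓ + 2) :
    WP χ B searchStep s fun t s' => t ≤ M * 11 + 10 ∧ ∃ j < i, IsSearching ℓ M s₀ j s' := by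
  have hnB := h.n_le
  have hMn := h.M_le
  have hℓr := h.ℓr_le
  have h3ℓ := h.three_le_ℓ
  obtain ⟨D, hD⟩ := hs.state
  have hc : Constants k ℓ r n M s := hs₀.constants.congr fun x hx _ => hs.reg x hx
  set m := s.reg 20 with hm
  have hm1 := hD.one_le
  set w := s.arr 7 (m - 1) with hw
  -- At the root, cell `0` of the path is read; its value `0` keeps the address in range.
  have hwM : w < M := by
    by_cases hm' : m = 1
    · rw [hw, hm', hs.root]
      omega
    · exact hD.lt _ (by omega) (by omega)
  have h2 : s.arr 2 w = w * M := by
    rw [hs.arr 2 (by omega) (by omega)]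
    exact hs₀.multiples w hwM
  have h9 : s.reg 9 = s₀.reg 9 := hs.reg 9 (by omega)
  have h3 : s.arr 3 = s₀.arr 3 := hs.arr 3 (by omega) (by omega)
  have hw1 := h.mul_M_le (show w + 1 ≤ M by omega)
  rw [add_mul, one_mul] at hw1
  simp only [searchStep, wp_seq, wp_sub, wp_load, wp_move, wp_const]
  simp [hc.r4, hc.r7, ← hm, ← hw, h2]
  refine (wp_for M 10 (fun v s' => s'.arr = s.arr ∧
    (∀ x, x < 22 → s'.reg x = s.reg x) ∧ s'.reg 24 = w * M ∧ s'.reg 26 = v ∧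
    -- The value `M` means that no unvisited neighbor has been found so far.
    ((s'.reg 25 = M ∧ ∀ v' < v, (m = 1 ∨ chosen M s₀ w v') → s.arr 6 v' ≠ 0) ∨
      (s'.reg 25 < M ∧ (m = 1 ∨ chosen M s₀ w (s'.reg 25)) ∧ s.arr 6 (s'.reg 25) = 0)))
    ?_ ?_ ?_).mono ?_
  · rintro v s' - ⟨-, hreg, -, h26, -⟩
    rw [holds_lt, h26, hreg 7 (by omega), hc.r7]
  · rintro v s' hv ⟨harr, hreg, h24, h26, hfound⟩
    have e4 := (hreg 4 (by omega)).trans hc.r4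
    have e9 := (hreg 9 (by omega)).trans h9
    have e10 := (hreg 10 (by omega)).trans hc.r10
    have e20 := hreg 20 (by omega)
    rw [← hm] at e20
    have haccept : (m = 1 ∨ chosen M s₀ w v) → s.arr 6 v = 0 →
        (v = M ∧ ∀ v' ≤ v, m = 1 ∨ chosen M s₀ w v' → ¬ s.arr 6 v' = 0) ∨
          v < M ∧ (m = 1 ∨ chosen M s₀ w v) ∧ s.arr 6 v = 0 :=
      fun hG h6 => Or.inr ⟨hv, hG, h6⟩
    have hreject : ((m = 1 ∨ chosen M s₀ w v) → ¬ s.arr 6 v = 0) →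
        (s'.reg 25 = M ∧ ∀ v' ≤ v, m = 1 ∨ chosen M s₀ w v' → ¬ s.arr 6 v' = 0) ∨
          s'.reg 25 < M ∧ (m = 1 ∨ chosen M s₀ w (s'.reg 25)) ∧ s.arr 6 (s'.reg 25) = 0 := by
      refine fun hG => hfound.imp_left fun hf => ⟨hf.1, fun v' hv' => ?_⟩
      rcases Nat.lt_or_eq_of_le hv' with hv' | rfl
      · exact hf.2 v' hv'
      · exact hG
    simp only [wp_seq, wp_load, wp_add, wp_ite, wp_move, wp_skip, holds_eq]
    simp [h24, h26, e4, e9, e10, e20, harr, h3]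
    refine ⟨by omega, fun hm' => ⟨fun h6 => ⟨by omega, ?_, haccept (Or.inl hm') h6⟩,
      fun h6 => ⟨by omega, ?_, hreject fun _ => h6⟩⟩,
      fun hm' => ⟨fun hG => ⟨fun h6 => ⟨by omega, ?_, haccept (Or.inr hG) h6⟩,
        fun h6 => ⟨by omega, ?_, hreject fun _ => h6⟩⟩,
        fun hG => ⟨by omega, ?_, hreject fun hor => absurd hor (not_or_intro hm' hG)⟩⟩⟩
    all_goals
      intro x hx
      have := hreg x hx
      split_ifs <;> omega
  · refine ⟨rfl, ?_, by simp, by simp, Or.inl ⟨by simp, by omega⟩⟩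
    intro x hx
    simp [show x ≠ 22 by omega, show x ≠ 23 by omega, show x ≠ 24 by omega,
      show x ≠ 25 by omega, show x ≠ 26 by omega]
  rintro t s' ⟨ht, harr, hreg, -, -, hfound⟩
  have e4 := (hreg 4 (by omega)).trans hc.r4
  have e7 := (hreg 7 (by omega)).trans hc.r7
  have e20 := hreg 20 (by omega)
  rw [← hm] at e20
  have hreg' : ∀ x < 11, s'.reg x = s₀.reg x := fun x hx =>
    (hreg x (by omega)).trans (hs.reg x hx)
  have e21 := (hreg 21 (by omega)).trans hs.r21
  have hmeas := hs.measure
  rw [← hm] at hmeas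
  simp only [wp_seq, wp_ite, wp_store, wp_add, wp_sub, holds_lt]
  simp only [e4, e7, e20, reg_setArr]
  constructor
  · intro hv
    obtain ⟨-, hG, h6⟩ := hfound.resolve_left fun hf => hv.ne hf.1
    set v := s'.reg 25 with hvdef
    have hvV : v ∉ visitedSet M s := by simp [mem_visitedSet hv, h6]
    refine ⟨by omega, by omega, i - 1, ?_, ?_⟩
    · have := visitedSet_card_le (M := M) (s := s)
      omega
    have hV : ∀ s'' : Memory, s''.arr 6 = Function.update (s.arr 6) v 1 →
        visitedSet M s'' = insert v (visitedSet M s) := by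
      intro s'' hs''
      ext x
      simp only [visitedSet, Finset.mem_filter, Finset.mem_insert, Finset.mem_range, hs'',
        Function.update_apply]
      split_ifs with hx
      · simp [hx, hv]
      · simp [hx]
    have hpush := hD.push hv hvV hG
    have hVs := hV (((s'.setArr 7 m v).setArr 6 v 1).setReg 20 (m + 1)) (by simp [harr])
    refine ⟨?_, by simp [e21], ?_, ?_, by simp; omega, ?_, D, ?_⟩
    · intro x hx
      simp [show x ≠ 20 by omega, hreg' x hx]
    · intro a ha6 ha7
      simp [ha6, ha7, harr, hs.arr a ha6 ha7]
    · simp [harr, show (0 : ℕ) ≠ m by omega, hs.root]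
    · rw [hVs, Finset.card_insert_of_notMem hvV]
      have := visitedSet_card_le (M := M) (s := s)
      simp
      omega
    · rw [hVs]
      simpa [harr] using hpush
  · intro hv
    have hdead := (hfound.resolve_right fun hf => hv hf.1).2
    have hVs : visitedSet M (s'.setReg 20 (m - 1)) = visitedSet M s := by
      simp [visitedSet, harr]
    have hsymm : ∀ a b, b < a → a < M → chosen M s₀ a b → chosen M s₀ b a := by
      intro a b hb ha hab
      rw [chosen, hs₀.symm a b hb ha]
      exact hab
    -- The root never needs deleting: otherwise everything has been visited, and the chosen class
    -- has at most `(ℓ - 1) * M < ℓ * M` pairs.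
    have hm2 : 2 ≤ m := by
      by_contra hm2
      have hm1' : m = 1 := by omega
      rw [hm1'] at hD
      have hle := hD.card_edgePairs_le fun v hv =>
        (mem_visitedSet hv).2 (hdead v hv (Or.inl hm1'))
      have hmany : ℓ * M ≤ (edgePairs (chosen M s₀) M).card := hs₀.many
      have : (ℓ - 1) * M < ℓ * M := Nat.mul_lt_mul_of_pos_right (by omega) (by omega)
      omega
    have hpop := hD.pop hsymm hm2 (by omega)
      fun v hv hvV hG => hvV ((mem_visitedSet hv).2 (hdead v hv (Or.inr hG)))
    refine ⟨by omega, i - 1, ?_, ?_⟩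
    · have := visitedSet_card_le (M := M) (s := s)
      omega
    refine ⟨?_, by simp [e21], ?_, by simp [harr, hs.root], by simp; omega, ?_, insert w D, ?_⟩
    · intro x hx
      simp [show x ≠ 20 by omega, hreg' x hx]
    · intro a ha6 ha7
      simp [harr, hs.arr a ha6 ha7]
    · rw [hVs]
      have := visitedSet_card_le (M := M) (s := s)
      simp
      omega
    · rw [hVs]
      simpa [harr] using hpop

/-- In the memory `s` a path with `ℓ` edges of the chosen color has been found. -/
structure IsPathFound (ℓ M : ℕ) (χ : Edge n k → Fin r) (s : Memory) : Prop where
  constants : Constants k ℓ r n M s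
  lt : ∀ i ≤ ℓ, s.arr 7 (i + 1) < M
  ne : ∀ i j, i < j → j ≤ ℓ → s.arr 7 (i + 1) ≠ s.arr 7 (j + 1)
  good : ∀ i < ℓ, ℓ ≤ blockCount χ M (s.arr 7 (i + 1)) (s.arr 7 (i + 2)) (s.reg 9) (ℓ * r)
  unused : ∀ j, s.arr 8 j = 0

theorem wp_search (h : Setting k ℓ r n M B) (hs : IsColored ℓ M χ s) :
    WP χ B search s fun t s' => t ≤ 60 * (n * n) ∧ IsPathFound ℓ M χ s' := by
  have hnB := h.n_le
  have hMn := h.M_le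
  have hℓr := h.ℓr_le
  have h3ℓ := h.three_le_ℓ
  have h8 := h.eight_le_n
  simp only [search, wp_seq, wp_const, wp_add]
  simp [hs.constants.r1, hs.constants.r4]
  refine ⟨by omega, by omega, ?_⟩
  -- Initially `m = 1` and all `M` vertices are unvisited, so the potential is `2 * M + 1`.
  refine (wp_while (M * 11 + 10) (IsSearching ℓ M s) ?_ (i := 2 * M + 1) ?_).mono ?_
  · intro i s' hs' hlt
    rw [holds_lt, hs'.r21] at hlt
    exact wp_searchStep h hs hs' hlt
  · have hV : ∀ s' : Memory, s'.arr = s.arr → visitedSet M s' = ∅ := by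
      intro s' hs'
      simp [visitedSet, hs', hs.rest 6]
    refine ⟨?_, by simp, fun _ _ _ => rfl, hs.rest 7 (by omega) 0, by simp, by simp, ∅, ?_⟩
    · intro x hx
      simp [show x ≠ 20 by omega, show x ≠ 21 by omega]
    · have hV' := hV (((s.setReg 20 1).setReg 21 (ℓ + 1)).setReg 21 (ℓ + 1 + 1)) rfl
      rw [hV']
      simpa using isSearchState_empty
  · rintro t s' ⟨ht, ⟨i, hs'⟩, hnlt⟩
    rw [holds_lt, hs'.r21] at hnlt
    have hm : s'.reg 20 = ℓ + 2 := le_antisymm hs'.le (by omega)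
    obtain ⟨D, hD⟩ := hs'.state
    rw [hm] at hD
    have hlt : ∀ i ≤ ℓ, s'.arr 7 (i + 1) < M := fun i hi => hD.lt _ (by omega) (by omega)
    have hne : ∀ i j, i < j → j ≤ ℓ → s'.arr 7 (i + 1) ≠ s'.arr 7 (j + 1) := fun i j hij hj =>
      hD.inj _ _ (by omega) (by omega) (by omega)
    refine ⟨?_, hs.constants.congr fun x hx _ => hs'.reg x hx, hlt, hne, ?_, ?_⟩
    · have h1 : (2 * M + 1) * (M * 11 + 10 + 1) ≤ (2 * n + 1) * (n * 11 + 11) :=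
        Nat.mul_le_mul (by omega) (by omega)
      have h2 : (2 * n + 1) * (n * 11 + 11) = 22 * (n * n) + 33 * n + 11 := by ring
      have h3 : 8 * n ≤ n * n := Nat.mul_le_mul_right _ h8
      omega
    · intro i hi
      have hadj : s.arr 3 (s'.arr 7 (i + 1) * M + s'.arr 7 (i + 2)) = s.reg 9 :=
        hD.adj (i + 1) (by omega) (by omega)
      rw [hs'.reg 9 (by omega), ← hadj]
      exact hs.good _ (hlt i hi.le) _ (hlt (i + 1) hi) (hne i (i + 1) (by omega) hi)
    · intro j
      rw [hs'.arr 8 (by omega) (by omega)]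
      exact hs.rest 8 (by omega) j

end

section

variable {n k ℓ r M B : ℕ} {s s' : Memory} {χ : Edge n k → Fin r}

/-! ### Extending the path to a loose path -/

/-- Find an unused block, with number in register `15` and first vertex in register `16`, that
gives the chosen color to the pair in registers `30, 31`. -/
def chooseBlock : Program :=
  .seq (.move 15 6) <| .seq (.move 32 7) <| .seq (.const 14 0) <|
  .loop (.lt 14 6) <|
    -- The start of the block is saved because the query moves register `32` on.
    .seq (.move 17 32) <| .seq queryBlock <|
    .seq (.ite (.eq 33 9)
      (.seq (.load 50 8 14) (.ite (.eq 50 10) (.seq (.move 15 14) (.move 16 17)) .skip)) .skip)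
      (.add 14 14 4)

/-- Append the vertex in register `30` and the block chosen last to the output. -/
def writeBlock : Program :=
  .seq (.store 8 15 4) <| .seq (.store 0 12 30) <| .seq (.add 12 12 4) <| .seq (.const 14 0) <|
  .loop (.lt 14 5) <|
    .seq (.store 0 12 16) <| .seq (.add 12 12 4) <| .seq (.add 16 16 4) (.add 14 14 4)

/-- Write the loose path that arises from the path in array `7` to the output. -/
def extendPath : Program :=
  .seq (.const 11 0) <| .seq (.const 12 0) <|
  .seq (.loop (.lt 11 1) <|
    .seq (.add 11 11 4) <| .seq (.load 30 7 11) <| .seq (.add 50 11 4) <| .seq (.load 31 7 50) <|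
    .seq chooseBlock writeBlock) <|
  -- The loop writes the first joint and the block of every edge; the last joint remains.
  .seq (.add 50 11 4) <| .seq (.load 50 7 50) (.store 0 12 50)

theorem wp_chooseBlock (h : Setting k ℓ r n M B) (hs : Constants k ℓ r n M s) {u v c : ℕ}
    (hu : s.reg 30 = u) (hv : s.reg 31 = v) (huM : u < M) (hvM : v < M) (huv : u ≠ v)
    (hc : s.reg 9 = c) (hex : ∃ j < ℓ * r, blockColor χ M u v j = c ∧ s.arr 8 j = 0) :
    WP χ B chooseBlock s fun t s' => t ≤ ℓ * r * (5 * k + 12) + 4 ∧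
      (∃ j < ℓ * r, s'.reg 15 = j ∧ s'.reg 16 = M + j * (k - 2) ∧ blockColor χ M u v j = c ∧
        s.arr 8 j = 0) ∧
      (∀ x < 32, (x < 14 ∨ 17 < x) → s'.reg x = s.reg x) ∧ ∀ a, a ≠ 1 → s'.arr a = s.arr a := by
  have hnB := h.n_le
  have hMn := h.M_le
  have hℓr := h.ℓr_le
  simp only [chooseBlock, wp_seq, wp_move, wp_const]
  refine (wp_for (ℓ * r) (5 * k + 11) (fun j s' => s'.reg 14 = j ∧
    s'.reg 32 = M + j * (k - 2) ∧ (∀ x < 32, (x < 14 ∨ 17 < x) → s'.reg x = s.reg x) ∧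
    (∀ a, a ≠ 1 → s'.arr a = s.arr a) ∧
    ((∃ i < ℓ * r, s'.reg 15 = i ∧ s'.reg 16 = M + i * (k - 2) ∧ blockColor χ M u v i = c ∧
        s.arr 8 i = 0) ∨
      ∀ i < j, blockColor χ M u v i = c → s.arr 8 i ≠ 0)) ?_ ?_ ?_).mono ?_
  · rintro j s' - ⟨h14, -, hreg, -⟩
    rw [holds_lt, h14, hreg 6 (by omega) (by omega), hs.r6]
  · rintro j s' hj ⟨h14, h32, hreg, harr, hfound⟩
    have hs' : Constants k ℓ r n M (s'.setReg 17 (s'.reg 32)) :=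
      hs.congr fun x hx _ => by
        simp [show x ≠ 17 by omega, hreg x (by omega) (by omega)]
    simp only [wp_seq, wp_move]
    refine (wp_queryBlock (u := u) (v := v) h hs'
      (by simpa using (hreg 30 (by omega) (by omega)).trans hu)
      (by simpa using (hreg 31 (by omega) (by omega)).trans hv) huM hvM huv hj
      (by simpa using h32)).mono ?_
    rintro t s'' ⟨ht, h33, h32'', hreg'', harr''⟩
    have hs'' : Constants k ℓ r n M s'' := hs'.congr fun x hx _ => hreg'' x (by omega)
    have h9 : s''.reg 9 = c := by
      rw [hreg'' 9 (by omega), ← hc, ← hreg 9 (by omega) (by omega)]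
      simp
    have h14'' : s''.reg 14 = j := by
      rw [hreg'' 14 (by omega), ← h14]
      simp
    have h17 : s''.reg 17 = M + j * (k - 2) := by
      rw [hreg'' 17 (by omega), ← h32]
      simp
    have h15 : s''.reg 15 = s'.reg 15 := by
      rw [hreg'' 15 (by omega)]
      simp
    have h16 : s''.reg 16 = s'.reg 16 := by
      rw [hreg'' 16 (by omega)]
      simp
    have h8 : s''.arr 8 = s.arr 8 := (harr'' 8 (by omega)).trans (harr 8 (by omega))
    have hframe : ∀ x < 32, (x < 14 ∨ 17 < x) → s''.reg x = s.reg x := by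
      intro x hx hx'
      rw [hreg'' x hx, ← hreg x hx hx']
      simp [show x ≠ 17 by omega]
    have harr3 : ∀ a, a ≠ 1 → s''.arr a = s.arr a := fun a ha => (harr'' a ha).trans (harr a ha)
    have hreject : (blockColor χ M u v j = c → ¬ s.arr 8 j = 0) →
        (s'.reg 15 < ℓ * r ∧ s'.reg 16 = M + s'.reg 15 * (k - 2) ∧
          blockColor χ M u v (s'.reg 15) = c ∧ s.arr 8 (s'.reg 15) = 0) ∨
        ∀ i ≤ j, blockColor χ M u v i = c → ¬ s.arr 8 i = 0 := by
      intro hno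
      rcases hfound with ⟨i, hi, rfl, hrest⟩ | hfound
      · exact Or.inl ⟨hi, hrest⟩
      · refine Or.inr fun i hi => ?_
        rcases Nat.lt_or_eq_of_le hi with hi | rfl
        · exact hfound i hi
        · exact hno
    simp only [wp_seq, wp_load, wp_add, wp_ite, wp_move, wp_skip, holds_eq]
    simp [h33, h9, h14'', h17, h8, hs''.r4, hs''.r10, h15, h16]
    refine ⟨fun hcol => ⟨fun h0 => ⟨by omega, by omega, h32'', ?_, harr3, Or.inl ⟨hj, hcol, h0⟩⟩,
      fun h0 => ⟨by omega, by omega, h32'', ?_, harr3, hreject fun _ => h0⟩⟩,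
      fun hcol => ⟨by omega, by omega, h32'', ?_, harr3, hreject fun h => absurd h hcol⟩⟩
    all_goals
      intro x hx hx'
      have := hframe x hx hx'
      split_ifs <;> omega
  · refine ⟨by simp, by simp [hs.r7], ?_, fun _ _ => rfl, Or.inr (by omega)⟩
    intro x hx hx'
    simp [show x ≠ 14 by omega, show x ≠ 15 by omega, show x ≠ 32 by omega]
  · rintro t s' ⟨ht, -, -, hreg, harr, hfound⟩
    have e : ℓ * r * (5 * k + 11 + 1) = ℓ * r * (5 * k + 12) := by ring
    refine ⟨by omega, hfound.resolve_right fun hno => ?_, hreg, harr⟩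
    obtain ⟨j, hj, hcol, h0⟩ := hex
    exact hno j hj hcol h0

theorem wp_writeBlock (h : Setting k ℓ r n M B) (hs : Constants k ℓ r n M s) {u j f o : ℕ}
    (hu : s.reg 30 = u) (hj : s.reg 15 = j) (hf : s.reg 16 = f) (ho : s.reg 12 = o)
    (hfn : f + (k - 2) ≤ n) (hon : o + (k - 1) ≤ n) :
    WP χ B writeBlock s fun t s' => t ≤ 5 * k + 6 ∧ s'.reg 12 = o + (k - 1) ∧
      (∀ x < 12, s'.reg x = s.reg x) ∧ (∀ a, a ≠ 0 → a ≠ 8 → s'.arr a = s.arr a) ∧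
      s'.arr 8 = Function.update (s.arr 8) j 1 ∧ (∀ x < o, s'.arr 0 x = s.arr 0 x) ∧
      s'.arr 0 o = u ∧ ∀ i < k - 2, s'.arr 0 (o + 1 + i) = f + i := by
  have hnB := h.n_le
  have h8 := h.eight_le_n
  have hk := h.two_le_k
  simp only [writeBlock, wp_seq, wp_store, wp_add, wp_const]
  simp [hs.r4, ho, hu, hj]
  refine ⟨by omega, ?_⟩
  refine (wp_for (k - 2) 4 (fun i s' => s'.reg 14 = i ∧ s'.reg 12 = o + 1 + i ∧
    s'.reg 16 = f + i ∧ (∀ x < 12, s'.reg x = s.reg x) ∧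
    (∀ a, a ≠ 0 → a ≠ 8 → s'.arr a = s.arr a) ∧
    s'.arr 8 = Function.update (s.arr 8) j 1 ∧ (∀ x < o, s'.arr 0 x = s.arr 0 x) ∧
    s'.arr 0 o = u ∧ ∀ i' < i, s'.arr 0 (o + 1 + i') = f + i') ?_ ?_ ?_).mono ?_
  · rintro i s' - ⟨h14, -, -, hreg, -⟩
    rw [holds_lt, h14, hreg 5 (by omega), hs.r5]
  · rintro i s' hi ⟨h14, h12, h16, hreg, harr, h8', hlt, hout, hblock⟩
    have h4 := (hreg 4 (by omega)).trans hs.r4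
    simp only [wp_seq, wp_store, wp_add]
    simp [h14, h12, h16, h4, h8']
    refine ⟨by omega, by omega, by omega, by omega, by omega, ?_, ?_, ?_, ?_, ?_⟩
    · intro x hx
      simp [show x ≠ 12 by omega, show x ≠ 14 by omega, show x ≠ 16 by omega, hreg x hx]
    · intro a ha0 ha8
      simp [ha0, harr a ha0 ha8]
    · intro x hx
      rw [Function.update_of_ne (by omega), hlt x hx]
    · rw [Function.update_of_ne (by omega), hout]
    · intro i' hi'
      rcases Nat.lt_or_eq_of_le hi' with hi' | rfl
      · rw [Function.update_of_ne (by omega), hblock i' hi']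
      · rw [Function.update_self]
  · refine ⟨by simp, by simp, by simp [hf], ?_, ?_, by simp, ?_, by simp, by omega⟩
    · intro x hx
      simp [show x ≠ 12 by omega, show x ≠ 14 by omega]
    · intro a ha0 ha8
      simp [ha0, ha8]
    · intro x hx
      simp [hx.ne]
  · rintro t s' ⟨ht, -, h12, -, hreg, harr, h8', hlt, hout, hblock⟩
    exact ⟨by omega, by omega, hreg, harr, h8', hlt, hout, hblock⟩

/-- The first `i` edges of the loose path have been written to the output. -/
structure IsWritten (ℓ M : ℕ) (χ : Edge n k → Fin r) (s₀ : Memory) (b : ℕ → ℕ) (i : ℕ)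
    (s : Memory) : Prop where
  reg : ∀ x < 11, s.reg x = s₀.reg x
  r11 : s.reg 11 = i
  r12 : s.reg 12 = i * (k - 1)
  path : s.arr 7 = s₀.arr 7
  lt : ∀ j < i, b j < ℓ * r
  color : ∀ j < i, blockColor χ M (s₀.arr 7 (j + 1)) (s₀.arr 7 (j + 2)) (b j) = s₀.reg 9
  ne : ∀ j j', j < j' → j' < i → b j ≠ b j'
  used : ∀ a, s.arr 8 a ≠ 0 → ∃ j < i, b j = a
  unused : ∀ a, s.arr 8 a = 0 → ∀ j < i, b j ≠ a
  out : ∀ x < i * (k - 1), s.arr 0 x = pathVertex k M (fun j => s₀.arr 7 (j + 1)) b x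

/-- Positions below `i * (k - 1)` belong to earlier edges, so choosing the `i`-th block leaves the
output written so far correct. -/
theorem pathVertex_update {p b : ℕ → ℕ} {i j x : ℕ} (hx : x < i * (k - 1)) :
    pathVertex k M p (Function.update b i j) x = pathVertex k M p b x := by
  have : x / (k - 1) ≠ i := by
    rw [mul_comm] at hx
    exact (Nat.div_lt_of_lt_mul hx).ne
  rw [pathVertex, pathVertex, Function.update_of_ne this]

theorem Setting.position_le (h : Setting k ℓ r n M B) {i : ℕ} (hi : i ≤ ℓ) :
    i * (k - 1) ≤ n := by
  have h1 := h.add_eq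
  have h2 := h.ℓr_le
  have h3 : ℓ * (k - 2) ≤ ℓ * r * (k - 2) :=
    Nat.mul_le_mul_right _ (Nat.le_mul_of_pos_right _ (by have := h.two_le_r; omega))
  have h4 : i * (k - 1) ≤ ℓ * (k - 1) := Nat.mul_le_mul_right _ hi
  have h5 : ℓ * (k - 1) = ℓ * (k - 2) + ℓ := by
    rw [← Nat.mul_succ]; congr 1; have := h.two_le_k; omega
  omega

/-- The greedy step: at least `ℓ` blocks give the pair the chosen color, and only `i < ℓ` blocks are
in use. -/
theorem wp_extendPath_step (h : Setting k ℓ r n M B) {s₀ : Memory} (hs₀ : IsPathFound ℓ M χ s₀)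
    {b : ℕ → ℕ} {i : ℕ} (hi : i < ℓ) (hs : IsWritten ℓ M χ s₀ b i s) :
    WP χ B (.seq (.add 11 11 4) <| .seq (.load 30 7 11) <| .seq (.add 50 11 4) <|
      .seq (.load 31 7 50) <| .seq chooseBlock writeBlock) s
      fun t s' => t ≤ ℓ * r * (5 * k + 12) + 5 * k + 14 ∧
        ∃ b', IsWritten ℓ M χ s₀ b' (i + 1) s' := by
  have hnB := h.n_le
  have hMn := h.M_le
  have hℓr := h.ℓr_le
  have hk := h.two_le_k
  have hc : Constants k ℓ r n M s := hs₀.constants.congr fun x hx _ => hs.reg x hx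
  have hne := hs₀.ne i (i + 1) (by omega) hi
  have hunused : ∃ j < ℓ * r, blockColor χ M (s₀.arr 7 (i + 1)) (s₀.arr 7 (i + 2)) j =
      s₀.reg 9 ∧ s.arr 8 j = 0 := by
    by_contra! hcon
    have hsub : (Finset.range (ℓ * r)).filter (fun j =>
        blockColor χ M (s₀.arr 7 (i + 1)) (s₀.arr 7 (i + 2)) j = s₀.reg 9) ⊆
        (Finset.range i).image b := by
      intro j hj
      rw [Finset.mem_filter, Finset.mem_range] at hj
      obtain ⟨j', hj', rfl⟩ := hs.used j (hcon j hj.1 hj.2)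
      exact Finset.mem_image_of_mem _ (Finset.mem_range.2 hj')
    have h1 : ℓ ≤ _ := (hs₀.good i hi).trans (Finset.card_le_card hsub)
    have h2 := h1.trans Finset.card_image_le
    rw [Finset.card_range] at h2
    omega
  simp only [wp_seq, wp_add, wp_load]
  simp [hs.r11, hc.r4, hs.path]
  refine ⟨by omega, by omega, ?_⟩
  refine (wp_chooseBlock (u := s₀.arr 7 (i + 1)) (v := s₀.arr 7 (i + 2)) (c := s₀.reg 9) h
    (hc.congr ?_) ?_ ?_ (hs₀.lt i hi.le) (hs₀.lt (i + 1) hi) hne ?_ ?_).mono ?_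
  · intro x hx _
    simp [show x ≠ 11 by omega, show x ≠ 30 by omega, show x ≠ 31 by omega, show x ≠ 50 by omega]
  · simp
  · simp
  · simp [hs.reg 9]
  · simpa using hunused
  rintro t s₁ ⟨ht, ⟨j, hj, h15, h16, hcol, h0⟩, hreg, harr⟩
  have hreg₁ : ∀ x < 11, s₁.reg x = s₀.reg x := by
    intro x hx
    rw [hreg x (by omega) (by omega), ← hs.reg x hx]
    simp [show x ≠ 11 by omega, show x ≠ 30 by omega, show x ≠ 31 by omega, show x ≠ 50 by omega]
  have harr₁ : ∀ a, a ≠ 1 → s₁.arr a = s.arr a := harr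
  have hend : M + (j + 1) * (k - 2) ≤ n := by
    rw [← h.add_eq]
    exact Nat.add_le_add_left (Nat.mul_le_mul_right _ hj) _
  rw [add_mul, one_mul] at hend
  have hpos := h.position_le (show i + 1 ≤ ℓ from hi)
  rw [add_mul, one_mul] at hpos
  refine (wp_writeBlock (u := s₀.arr 7 (i + 1)) (o := i * (k - 1)) h
    (hs₀.constants.congr fun x hx _ => hreg₁ x hx) ?_ h15 h16 ?_ (by omega) hpos).mono ?_
  · rw [hreg 30 (by omega) (by omega)]
    simp
  · rw [hreg 12 (by omega) (by omega)]
    simp [hs.r12]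
  rintro t' s₂ ⟨ht', h12, hreg₂, harr₂, h8₂, hlt₂, hout₂, hblock₂⟩
  rw [harr₁ 8 (by omega)] at h8₂
  have hbi : ∀ i' < i, Function.update b i j i' = b i' := fun i' hi' =>
    Function.update_of_ne hi'.ne _ _
  refine ⟨by omega, Function.update b i j, fun x hx => (hreg₂ x (by omega)).trans (hreg₁ x hx),
    ?_, by rw [h12]; ring, ?_, ?_, ?_, ?_, ?_, ?_, ?_⟩
  · rw [hreg₂ 11 (by omega), hreg 11 (by omega) (by omega)]
    simp
  · rw [harr₂ 7 (by omega) (by omega), harr₁ 7 (by omega), hs.path]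
  · intro i' hi'
    rcases Nat.lt_succ_iff_lt_or_eq.1 hi' with hi' | rfl
    · rw [hbi i' hi']; exact hs.lt i' hi'
    · rwa [Function.update_self]
  · intro i' hi'
    rcases Nat.lt_succ_iff_lt_or_eq.1 hi' with hi' | rfl
    · rw [hbi i' hi']; exact hs.color i' hi'
    · rwa [Function.update_self]
  · intro i₁ i₂ hlt₁₂ hi₂
    rw [hbi i₁ (by omega)]
    rcases Nat.lt_succ_iff_lt_or_eq.1 hi₂ with hi₂ | rfl
    · rw [hbi i₂ hi₂]; exact hs.ne i₁ i₂ hlt₁₂ hi₂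
    · rw [Function.update_self]; exact hs.unused j h0 i₁ hlt₁₂
  · intro a ha
    by_cases haj : a = j
    · exact ⟨i, by omega, by rw [Function.update_self, haj]⟩
    · rw [h8₂, Function.update_of_ne haj] at ha
      obtain ⟨i', hi', he⟩ := hs.used a ha
      exact ⟨i', by omega, by rw [hbi i' hi', he]⟩
  · intro a ha i' hi'
    by_cases haj : a = j
    · rw [haj, h8₂, Function.update_self] at ha
      omega
    · rw [h8₂, Function.update_of_ne haj] at ha
      rcases Nat.lt_succ_iff_lt_or_eq.1 hi' with hi' | rfl
      · rw [hbi i' hi']; exact hs.unused a ha i' hi'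
      · rw [Function.update_self]; exact Ne.symm haj
  · intro x hx
    rw [add_mul, one_mul] at hx
    rcases Nat.lt_or_ge x (i * (k - 1)) with hlt | hge
    · rw [pathVertex_update hlt, hlt₂ x hlt, harr₁ 0 (by omega), hs.out x hlt]
    · obtain ⟨d, rfl⟩ := Nat.exists_eq_add_of_le hge
      rcases d with _ | d
      · rw [add_zero, pathVertex_joint hk, hout₂]
      · have hd : i * (k - 1) + (d + 1) = i * (k - 1) + 1 + d := by ring
        rw [hd, pathVertex_inner (by omega), hblock₂ d (by omega), Function.update_self]

theorem wp_extendPath (h : Setting k ℓ r n M B) (hs : IsPathFound ℓ M χ s) :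
    WP χ B extendPath s fun t s' => t ≤ 80 * (n * n) ∧
      ∃ φ : Fin ((k - 1) * ℓ + 1) ↪ Fin n,
        (∀ i : Fin ((k - 1) * ℓ + 1), s'.arr 0 (i : ℕ) = (φ i : ℕ)) ∧
          IsMonochromaticCopy χ (loosePath k ℓ) φ := by
  have hnB := h.n_le
  have hMn := h.M_le
  have hℓr := h.ℓr_le
  have hk := h.two_le_k
  have h3ℓ := h.three_le_ℓ
  have h8 := h.eight_le_n
  simp only [extendPath, wp_seq, wp_const]
  refine (wp_for ℓ (ℓ * r * (5 * k + 12) + 5 * k + 14)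
    (fun i s' => ∃ b, IsWritten ℓ M χ s b i s') ?_ ?_ ?_).mono ?_
  · rintro i s' - ⟨b, hb⟩
    rw [holds_lt, hb.r11, hb.reg 1 (by omega), hs.constants.r1]
  · rintro i s' hi ⟨b, hb⟩
    exact wp_extendPath_step h hs hi hb
  · refine ⟨fun _ => 0, ?_, by simp, by simp, rfl, by omega, by omega, by omega, ?_, by omega,
      by omega⟩
    · intro x hx
      simp [show x ≠ 11 by omega, show x ≠ 12 by omega]
    · intro a ha
      exact absurd (hs.unused a) ha
  · rintro t s' ⟨ht, b, hb⟩
    have h4 := (hb.reg 4 (by omega)).trans hs.constants.r4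
    simp only [wp_add, wp_load, wp_store]
    simp [hb.r11, hb.r12, h4, hb.path]
    refine ⟨by omega, ?_, ?_⟩
    · have h1 := h.blocks_mul_k_le
      have h2 := h.position_le (show 1 ≤ ℓ by omega)
      -- Each of the `ℓ` rounds tries all blocks in linear time, and `ℓ ≤ n`.
      have h3 : ℓ * (ℓ * r * (5 * k + 12) + 5 * k + 14 + 1) ≤ n * (40 * n) := by
        refine Nat.mul_le_mul (by omega) ?_
        have : ℓ * r * (5 * k + 12) = 5 * (ℓ * r * k) + 12 * (ℓ * r) := by ring
        omega
      have h4 : n * (40 * n) = 40 * (n * n) := by ring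
      have h5 : 8 * n ≤ n * n := Nat.mul_le_mul_right _ h8
      omega
    · obtain ⟨φ, hφ, hmono⟩ := exists_monochromatic_copy (χ := χ) (c := s.reg 9) hk
        (show 1 ≤ ℓ by omega) h.add_eq.le (p := fun j => s.arr 7 (j + 1)) (b := b) hs.lt hs.ne
        hb.lt hb.ne hb.color
      refine ⟨φ, fun i => ?_, hmono⟩
      rw [← hφ i]
      have hi := i.2
      by_cases hlast : (i : ℕ) = ℓ * (k - 1)
      · rw [hlast, Function.update_self, pathVertex_joint hk]
      · rw [Function.update_of_ne hlast]
        have hcomm := mul_comm (k - 1) ℓ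
        exact hb.out i (by omega)

/-! ### The complete algorithm and its running time -/

/-- The algorithm that finds a monochromatic loose path. -/
def findLoosePath : Program :=
  .seq setUp <| .seq colorPairs <| .seq search extendPath

/-- The budgets `20 * n`, `60 * (n * n * n ^ (k - 2))`, `60 * (n * n)` and `80 * (n * n)` add up;
sequencing itself is free. -/
theorem wp_findLoosePath (h : Setting k ℓ r n M B) :
    WP χ B findLoosePath (input k ℓ r n) fun t s' => t ≤ 220 * (n * n * n ^ (k - 2)) ∧
      ∃ φ : Fin ((k - 1) * ℓ + 1) ↪ Fin n,
        (∀ i : Fin ((k - 1) * ℓ + 1), s'.arr 0 (i : ℕ) = (φ i : ℕ)) ∧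
          IsMonochromaticCopy χ (loosePath k ℓ) φ := by
  simp only [findLoosePath, wp_seq]
  refine (wp_setUp h).mono ?_
  rintro t₁ s₁ ⟨ht₁, hs₁, hmul, hzero⟩
  refine (wp_colorPairs h hs₁ hmul hzero).mono ?_
  rintro t₂ s₂ ⟨ht₂, hs₂⟩
  refine (wp_search h hs₂).mono ?_
  rintro t₃ s₃ ⟨ht₃, hs₃⟩
  refine (wp_extendPath h hs₃).mono ?_
  rintro t₄ s₄ ⟨ht₄, hs₄⟩
  refine ⟨?_, hs₄⟩
  have h8 := h.eight_le_n
  have h1 : n * n * 1 ≤ n * n * n ^ (k - 2) :=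
    Nat.mul_le_mul_left _ (Nat.one_le_pow _ _ (by omega))
  have h2 : 8 * n ≤ n * n := Nat.mul_le_mul_right _ h8
  omega

theorem setting_of_le (hk : 2 ≤ k) (hℓ : 3 ≤ ℓ) (hr : 2 ≤ r)
    (hn : 2 ^ (r + 1) * ℓ + (k - 2) * ℓ * r ≤ n) :
    Setting k ℓ r n (n - ℓ * r * (k - 2)) (n ^ k) := by
  have e : (k - 2) * ℓ * r = ℓ * r * (k - 2) := by ring
  rw [e] at hn
  have hpow : 2 ≤ 2 ^ (r + 1) := Nat.le_self_pow (by omega) 2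
  have h1 : 2 * ℓ ≤ 2 ^ (r + 1) * ℓ := Nat.mul_le_mul_right _ hpow
  -- With at least one block, `k - 2` is at most the total size of the blocks; this yields `k ≤ n`.
  have h2 : 1 * (k - 2) ≤ ℓ * r * (k - 2) :=
    Nat.mul_le_mul_right _ (Nat.mul_pos (by omega) (by omega))
  refine ⟨hk, hℓ, hr, by omega, by omega, ?_, ?_⟩
  · rw [← sq]
    exact Nat.pow_le_pow_right (by omega) hk
  · calc k ≤ n ^ 1 := by rw [pow_one]; omega
      _ ≤ n ^ k := Nat.pow_le_pow_right (by omega) (by omega)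

end

end LoosePath

theorem theorem2 :
    ∃ (A : LoosePath.Program) (c : ℝ), 0 < c ∧
      ∀ k ℓ r n : ℕ, 2 ≤ k → 3 ≤ ℓ → 2 ≤ r → 2 ^ (r + 1) * ℓ + (k - 2) * ℓ * r ≤ n →
        LoosePath.FindsLoosePath A c k ℓ r n := by
  refine ⟨LoosePath.findLoosePath, 220, by norm_num, fun k ℓ r n hk hℓ hr hn χ => ?_⟩
  obtain ⟨t, s, hexec, ht, hφ⟩ :=
    LoosePath.wp_findLoosePath (χ := χ) (LoosePath.setting_of_le hk hℓ hr hn)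
  refine ⟨t, s, hexec, ?_, hφ⟩
  have e : n * n * n ^ (k - 2) = n ^ k := by
    rw [← sq, ← pow_add]; congr 1; omega
  rw [e] at ht
  exact_mod_cast ht
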